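/- Let $X$ be a projective complex manifold (of pure dimension $d$) and let $L$ be an ample holomorphic line bundle on $X$, i.e. for some $k\ge 1$ finitely many holomorphic sections of $L^{\otimes k}$ without common zero define a closed holomorphic embedding of $X$ into a projective space. A continuous hermitian metric $\|\cdot\|$ on $L$ is called \emph{positive} if its first Chern current $c_1(L,\|\cdot\|)$, given locally by $dd^c(-\log\|s\|^2)$ for any nowhere vanishing local holomorphic section $s$ of $L$, is a positive current on $X$. A continuous positive metric $\|\cdot\|$ on $L$ is called \emph{admissible} if there is a sequence $(\|\cdot\|_n)_{n\in\mathbb N}$ of positive metrics of class $C^\infty$ on $L$ that converges uniformly to $\|\cdot\|$ on $X$, i.e. such that the functions $\|\cdot\|_n/\|\cdot\|$ on $X$ converge uniformly to $1$. Then every continuous positive hermitian metric on $L$ is admissible. -/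

import Mathlib

open Bundle Set Filter Topology MeasureTheory
open scoped Manifold ContDiff TensorProduct LinearAlgebra.Projectivization

noncomputable section

/-- The model space of complex manifolds of dimension `d`. -/
abbrev CC (d : ℕ) : Type := EuclideanSpace ℂ (Fin d)

/-! ### Positivity of `dd^c u` in the sense of currents, on open sets of `ℂ^d` -/

/-- The complex Hessian `∑ (∂²φ/∂z_j∂z̄_k)(z) ξ_j ξ̄_k` of a smooth real function `φ`,
written with the real second derivative: it equals `(D²φ(ξ, ξ) + D²φ(iξ, iξ)) / 4`. -/
def leviForm {d : ℕ} (φ : CC d → ℝ) (z ξ : CC d) : ℝ :=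
  (fderiv ℝ (fderiv ℝ φ) z ξ ξ +
    fderiv ℝ (fderiv ℝ φ) z (Complex.I • ξ) (Complex.I • ξ)) / 4

/-- The current `dd^c u` is positive on the open set `V ⊆ ℂ^d`, for `u` continuous on `V`: for
every vector `ξ` the distribution `∑ (∂²u/∂z_j∂z̄_k) ξ_j ξ̄_k` on `V` is positive. The distribution
acts on a test function `φ` by moving the derivatives to `φ`. -/
def DdcNonnegOn {d : ℕ} (V : Set (CC d)) (u : CC d → ℝ) : Prop :=
  ∀ φ : CC d → ℝ, ContDiff ℝ ∞ φ → HasCompactSupport φ → tsupport φ ⊆ V → (∀ z, 0 ≤ φ z) →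
    ∀ ξ : CC d, 0 ≤ ∫ z, u z * leviForm φ z ξ

section LineBundle

variable {d : ℕ} {X : Type*} [TopologicalSpace X] [ChartedSpace (CC d) X]
  {L : X → Type*} [TopologicalSpace (TotalSpace ℂ L)] [∀ x, AddCommGroup (L x)]
  [∀ x, Module ℂ (L x)] [∀ x, TopologicalSpace (L x)] [FiberBundle ℂ L]

variable (d) in
/-- `s` is a holomorphic section of `L`, without zeros, over the open set `U`. -/
structure IsHolomorphicFrame (U : Set X) (s : ∀ x, L x) : Prop where
  isOpen : IsOpen U
  holomorphic : ContMDiffOn 𝓘(ℂ, CC d) (𝓘(ℂ, CC d).prod 𝓘(ℂ, ℂ)) ω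
    (fun x ↦ TotalSpace.mk' ℂ x (s x)) U
  ne_zero : ∀ x ∈ U, s x ≠ 0

/-! ### Ample line bundles -/

variable (d) in
/-- `σ` is a holomorphic global section of `L^{⊗k}`: on each open set `U` where `L` has a
holomorphic frame `s`, one has `σ = f • s^{⊗k}` with `f` holomorphic on `U`. -/
def IsHolomorphicSectionPow (k : ℕ) (σ : ∀ x, ⨂[ℂ]^k (L x)) : Prop :=
  ∀ (U : Set X) (s : ∀ x, L x), IsHolomorphicFrame d U s →
    ∃ f : X → ℂ, ContMDiffOn 𝓘(ℂ, CC d) 𝓘(ℂ, ℂ) ω f U ∧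
      ∀ x ∈ U, σ x = f x • PiTensorProduct.tprod ℂ (fun _ : Fin k ↦ s x)

variable (d L) in
/-- `L^{⊗k}` is very ample: there are finitely many holomorphic sections `σ_0, …, σ_N` of
`L^{⊗k}` without common zero such that `φ = [σ_0 : ⋯ : σ_N] : X → ℙ^N(ℂ)` is injective and an
immersion (for each nonzero tangent vector `v` at `x`, the derivative along `v` of
some affine coordinate of `φ` does not vanish). On a compact `X` such a `φ` is a closed embedding,
and `L^{⊗k}` is the pullback of `O(1)` by `φ`. -/
def IsVeryAmplePow (k : ℕ) : Prop :=
  ∃ (N : ℕ) (σ : Fin (N + 1) → ∀ x, ⨂[ℂ]^k (L x)) (φ : X → ℙ ℂ (Fin (N + 1) → ℂ)),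
    (∀ i, IsHolomorphicSectionPow d k (σ i)) ∧
    (∀ x, ∃ e : ⨂[ℂ]^k (L x), e ≠ 0 ∧ ∀ i, σ i x = (φ x).rep i • e) ∧
    Function.Injective φ ∧
    ∀ (x : X) (v : TangentSpace 𝓘(ℂ, CC d) x), v ≠ 0 →
      ∃ i j, (φ x).rep i ≠ 0 ∧
        mfderiv 𝓘(ℂ, CC d) 𝓘(ℂ, ℂ) (fun y ↦ (φ y).rep j / (φ y).rep i) x v ≠ 0

variable (d L) in
/-- `L` is ample: some power `L^{⊗k}`, `k ≥ 1`, is very ample. -/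
def IsAmple : Prop := ∃ k : ℕ, 0 < k ∧ IsVeryAmplePow d L k

/-! ### Hermitian metrics -/

/-- A hermitian metric (with no regularity condition) on the line bundle `L`: a norm on each
fibre. The fibres are complex lines, so that each norm on a fibre is hermitian. -/
structure HermitianMetric {X : Type*} (L : X → Type*) [∀ x, AddCommGroup (L x)]
    [∀ x, Module ℂ (L x)] where
  /-- the norm on the fibre at `x` -/
  fiberNorm : ∀ x, Seminorm ℂ (L x)
  pos : ∀ x (v : L x), v ≠ 0 → 0 < fiberNorm x v

namespace HermitianMetric

variable (d) in
/-- The metric is continuous: `‖s‖` is continuous for each local holomorphic frame `s`. -/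
def IsContinuous (h : HermitianMetric L) : Prop :=
  ∀ (U : Set X) (s : ∀ x, L x), IsHolomorphicFrame d U s →
    ContinuousOn (fun x ↦ h.fiberNorm x (s x)) U

variable (d) in
/-- The metric is of class `C^∞` (in the real sense): `‖s‖` is `C^∞` for each local holomorphic
frame `s`. -/
def IsSmooth (h : HermitianMetric L) : Prop :=
  ∀ (U : Set X) (s : ∀ x, L x), IsHolomorphicFrame d U s →
    ContMDiffOn 𝓘(ℝ, CC d) 𝓘(ℝ, ℝ) ∞ (fun x ↦ h.fiberNorm x (s x)) U

variable (d) in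
/-- The metric (supposed to be continuous) is positive: its first Chern current, locally equal to
`dd^c (-log ‖s‖²)` for each local holomorphic frame `s`, is positive. This is expressed
in the charts `c` of `X`. -/
def IsPositive (h : HermitianMetric L) : Prop :=
  ∀ (U : Set X) (s : ∀ x, L x), IsHolomorphicFrame d U s →
    ∀ c ∈ atlas (CC d) X,
      DdcNonnegOn (c.target ∩ c.symm ⁻¹' U)
        (fun z ↦ -Real.log (h.fiberNorm (c.symm z) (s (c.symm z)) ^ 2))

/-- Uniform convergence on `X` of a sequence of metrics: the ratios `‖·‖_n / ‖·‖`, which are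
functions on `X`, converge uniformly to `1`. -/
def TendstoUnif (h' : ℕ → HermitianMetric L) (h : HermitianMetric L) : Prop :=
  ∀ ε : ℝ, 0 < ε → ∀ᶠ n in atTop, ∀ (x : X) (v : L x),
    |(h' n).fiberNorm x v - h.fiberNorm x v| ≤ ε * h.fiberNorm x v

variable (d) in
/-- The metric is admissible: it is continuous, positive, and a uniform limit on `X` of a sequence
of positive metrics of class `C^∞`. -/
def IsAdmissible (h : HermitianMetric L) : Prop :=
  h.IsContinuous d ∧ h.IsPositive d ∧
    ∃ h' : ℕ → HermitianMetric L,
      (∀ n, (h' n).IsSmooth d ∧ (h' n).IsPositive d) ∧ TendstoUnif h' h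

end HermitianMetric

end LineBundle

end

/-! Let `F` be the vector of components, in a frame `s` of `L`, of sections of `L^{⊗k}` that define
an immersion into projective space. The functions `p = k⁻¹ log ‖F‖²` are the local weights of the
Fubini–Study metric, and the immersion makes their Levi form positive definite
(`leviForm_log_norm_sq_pos`): they are potentials of a Kähler form ω. Any other metric has weights
`φ + p` with one global function `φ`; it is continuous and positive exactly when `φ` is continuous
and ω + dd^c φ ≥ 0. It remains to approximate `φ` uniformly by smooth `ψ` with ω + dd^c ψ ≥ 0
(`IsKahlerPotential.exists_smooth_approx`).

In a chart, convolution approximates `φ + p` by smooth plurisubharmonic functions; the point is to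
glue these without losing positivity. Take `v` within `1/m` of `φ + p` and put `g = m (v - p)`, so
that `|g - mφ| ≤ 1` and the Levi form of `g` is at least `-mω`. With finitely many cut-offs `θ_x`
whose sets `{θ_x = 1}` cover `X`, put `S = ∑ θ_x² exp(g_x)`. By `leviForm_log_sum_sq_ge` and
`leviForm_mul_exp`, gluing costs at most a constant times `exp(mφ + 1) ω / S`, with a constant that
does not depend on `m`, while `S ≥ exp(mφ - 1)`. Hence dd^c log S ≥ -(m + C)ω with `C` fixed, and `ψ
= log S / (m + C)` satisfies ω + dd^c ψ ≥ 0 with no loss. Since `log S - mφ` is bounded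
independently of `m`, `ψ` tends uniformly to `φ` as `m → ∞`. -/

section LeviCalculus

/-! ### Two derivatives along a curve -/

/-- The curve `f` is differentiable near `0`, with first derivative `a` and second derivative `b`
at `0`. -/
def HasTwoDerivs {E : Type*} [NormedAddCommGroup E] [NormedSpace ℝ E] (f : ℝ → E) (a b : E) :
    Prop :=
  ∃ f' : ℝ → E, (∀ᶠ t in 𝓝 0, HasDerivAt f (f' t) t) ∧ f' 0 = a ∧ HasDerivAt f' b 0

namespace HasTwoDerivs

section General

variable {E F : Type*} [NormedAddCommGroup E] [NormedSpace ℝ E] [NormedAddCommGroup F]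
  [NormedSpace ℝ F]

theorem unique {f : ℝ → E} {a b a' b' : E} (h : HasTwoDerivs f a b) (h' : HasTwoDerivs f a' b') :
    a = a' ∧ b = b' := by
  obtain ⟨f₁, h₁, rfl, h₂⟩ := h
  obtain ⟨f₂, h₃, rfl, h₄⟩ := h'
  have hev : f₁ =ᶠ[𝓝 0] f₂ := by
    filter_upwards [h₁, h₃] with t ht ht'
    exact ht.unique ht'
  exact ⟨hev.eq_of_nhds, (h₂.congr_of_eventuallyEq hev.symm).unique h₄⟩

theorem comp {g : ℝ → E} {a b : E} (hg : HasTwoDerivs g a b) {f : E → F}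
    (hf : ContDiffAt ℝ 2 f (g 0)) :
    HasTwoDerivs (fun t ↦ f (g t)) (fderiv ℝ f (g 0) a)
      (fderiv ℝ (fderiv ℝ f) (g 0) a a + fderiv ℝ f (g 0) b) := by
  obtain ⟨g', h₁, rfl, h₂⟩ := hg
  have hcont : ContinuousAt g 0 := h₁.self_of_nhds.continuousAt
  refine ⟨fun t ↦ fderiv ℝ f (g t) (g' t), ?_, rfl, ?_⟩
  · have h2 : ∀ᶠ x in 𝓝 (g 0), DifferentiableAt ℝ f x := by
      filter_upwards [hf.eventually (by simp)] with x hx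
      exact hx.differentiableAt (by simp)
    filter_upwards [h₁, hcont.eventually h2] with t ht ht'
    exact ht'.hasFDerivAt.comp_hasDerivAt t ht
  · have h3 : DifferentiableAt ℝ (fderiv ℝ f) (g 0) :=
      (hf.fderiv_right (m := 1) (by norm_num)).differentiableAt (by simp)
    exact (h3.hasFDerivAt.comp_hasDerivAt 0 h₁.self_of_nhds).clm_apply h₂

theorem line (z w : E) : HasTwoDerivs (fun t : ℝ ↦ z + t • w) w 0 := by
  refine ⟨fun _ ↦ w, .of_forall fun t ↦ ?_, rfl, hasDerivAt_const _ _⟩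
  simpa using ((hasDerivAt_id t).smul_const w).const_add z

theorem of_contDiffAt {f : E → F} {z : E} (hf : ContDiffAt ℝ 2 f z) (w : E) :
    HasTwoDerivs (fun t : ℝ ↦ f (z + t • w)) (fderiv ℝ f z w) (fderiv ℝ (fderiv ℝ f) z w w) := by
  simpa using (line z w).comp (f := f) (by simpa using hf)

theorem sum {ι : Type*} (s : Finset ι) {f : ι → ℝ → E} {a b : ι → E}
    (h : ∀ i ∈ s, HasTwoDerivs (f i) (a i) (b i)) :
    HasTwoDerivs (fun t ↦ ∑ i ∈ s, f i t) (∑ i ∈ s, a i) (∑ i ∈ s, b i) := by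
  choose! f' h₁ h₂ h₃ using h
  refine ⟨fun t ↦ ∑ i ∈ s, f' i t, ?_, Finset.sum_congr rfl h₂, HasDerivAt.fun_sum h₃⟩
  have : ∀ᶠ t in 𝓝 (0 : ℝ), ∀ i ∈ s, HasDerivAt (f i) (f' i t) t :=
    (Filter.eventually_all_finset s).2 h₁
  filter_upwards [this] with t ht
  exact HasDerivAt.fun_sum ht

end General

theorem mul {f g : ℝ → ℝ} {a b p q : ℝ} (hf : HasTwoDerivs f a b) (hg : HasTwoDerivs g p q) :
    HasTwoDerivs (fun t ↦ f t * g t) (a * g 0 + f 0 * p) (b * g 0 + 2 * a * p + f 0 * q) := by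
  obtain ⟨f', h₁, rfl, h₂⟩ := hf
  obtain ⟨g', h₃, rfl, h₄⟩ := hg
  refine ⟨fun t ↦ f' t * g t + f t * g' t, ?_, rfl, ?_⟩
  · filter_upwards [h₁, h₃] with t ht ht'
    exact ht.mul ht'
  · exact ((h₂.mul h₃.self_of_nhds).add (h₁.self_of_nhds.mul h₄)).congr_deriv (by ring)

theorem const_mul {f : ℝ → ℝ} {a b : ℝ} (c : ℝ) (hf : HasTwoDerivs f a b) :
    HasTwoDerivs (fun t ↦ c * f t) (c * a) (c * b) := by
  obtain ⟨f', h₁, rfl, h₂⟩ := hf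
  exact ⟨fun t ↦ c * f' t, h₁.mono fun t ht ↦ ht.const_mul c, rfl, h₂.const_mul c⟩

theorem exp {f : ℝ → ℝ} {a b : ℝ} (hf : HasTwoDerivs f a b) :
    HasTwoDerivs (fun t ↦ Real.exp (f t)) (Real.exp (f 0) * a)
      (Real.exp (f 0) * (b + a ^ 2)) := by
  obtain ⟨f', h₁, rfl, h₂⟩ := hf
  refine ⟨fun t ↦ Real.exp (f t) * f' t, h₁.mono fun t ht ↦ ht.exp, rfl, ?_⟩
  exact (h₁.self_of_nhds.exp.mul h₂).congr_deriv (by ring)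

theorem log {f : ℝ → ℝ} {a b : ℝ} (hf : HasTwoDerivs f a b) (h0 : f 0 ≠ 0) :
    HasTwoDerivs (fun t ↦ Real.log (f t)) (a / f 0) ((b * f 0 - a ^ 2) / f 0 ^ 2) := by
  obtain ⟨f', h₁, rfl, h₂⟩ := hf
  refine ⟨fun t ↦ f' t / f t, ?_, rfl, ?_⟩
  · filter_upwards [h₁, h₁.self_of_nhds.continuousAt.eventually_ne h0] with t ht ht'
    exact ht.log ht'
  · exact (h₂.div h₁.self_of_nhds h0).congr_deriv (by ring)

theorem norm_sq {E : Type*} [NormedAddCommGroup E] [InnerProductSpace ℂ E] [NormedSpace ℝ E]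
    {f : ℝ → E} {a b : E} (hf : HasTwoDerivs f a b) :
    HasTwoDerivs (fun t ↦ ‖f t‖ ^ 2) (2 * (inner ℂ (f 0) a).re)
      (2 * ‖a‖ ^ 2 + 2 * (inner ℂ (f 0) b).re) := by
  obtain ⟨f', h₁, rfl, h₂⟩ := hf
  refine ⟨fun t ↦ 2 * (inner ℂ (f t) (f' t)).re, ?_, rfl, ?_⟩
  · filter_upwards [h₁] with t ht
    have h := Complex.reCLM.hasFDerivAt.comp_hasDerivAt t (ht.inner ℂ ht)
    have e1 : (fun s ↦ ‖f s‖ ^ 2) = Complex.reCLM ∘ fun s ↦ inner ℂ (f s) (f s) := by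
      ext s
      exact (inner_self_eq_norm_sq (𝕜 := ℂ) (f s)).symm
    rw [e1]
    refine h.congr_deriv ?_
    simp only [Complex.reCLM_apply, Complex.add_re]
    rw [← inner_conj_symm (f' t) (f t), Complex.conj_re]
    ring
  · have h := (Complex.reCLM.hasFDerivAt.comp_hasDerivAt 0
      (h₁.self_of_nhds.inner ℂ h₂)).const_mul 2
    refine h.congr_deriv ?_
    simp only [Complex.reCLM_apply, Complex.add_re]
    have h' : (inner ℂ (f' 0) (f' 0)).re = ‖f' 0‖ ^ 2 := inner_self_eq_norm_sq (𝕜 := ℂ) (f' 0)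
    rw [h']
    ring

/-- The second derivative of a holomorphic map is complex bilinear: it changes sign when the
direction is multiplied by `I`. -/
theorem of_holomorphic {E F : Type*} [NormedAddCommGroup E] [NormedSpace ℂ E] [NormedSpace ℝ E]
    [IsScalarTower ℝ ℂ E] [NormedAddCommGroup F] [NormedSpace ℂ F] [NormedSpace ℝ F]
    [IsScalarTower ℝ ℂ F] {T : E → F} {z : E} (hT : ContDiffAt ℂ 2 T z) (w : E) :
    ∃ b, HasTwoDerivs (fun t : ℝ ↦ T (z + t • w)) (fderiv ℂ T z w) b ∧
      HasTwoDerivs (fun t : ℝ ↦ T (z + t • (Complex.I • w))) (Complex.I • fderiv ℂ T z w) (-b) := by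
  have key : ∀ w : E, HasTwoDerivs (fun t : ℝ ↦ T (z + t • w)) (fderiv ℂ T z w)
      (fderiv ℂ (fderiv ℂ T) z w w) := by
    intro w
    have hl : ∀ t : ℝ, HasDerivAt (fun t : ℝ ↦ z + t • w) w t := fun t ↦ by
      simpa using ((hasDerivAt_id t).smul_const w).const_add z
    have hc : Tendsto (fun t : ℝ ↦ z + t • w) (𝓝 0) (𝓝 z) := by
      simpa [ContinuousAt] using (hl 0).continuousAt
    refine ⟨fun t ↦ fderiv ℂ T (z + t • w) w, ?_, by simp, ?_⟩
    · have h2 : ∀ᶠ x in 𝓝 z, DifferentiableAt ℂ T x := by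
        filter_upwards [hT.eventually (by simp)] with x hx
        exact hx.differentiableAt (by simp)
      filter_upwards [hc.eventually h2] with t ht
      exact (ht.hasFDerivAt.restrictScalars ℝ).comp_hasDerivAt t (hl t)
    · have h3 : DifferentiableAt ℂ (fderiv ℂ T) z :=
        (hT.fderiv_right (m := 1) (by norm_num)).differentiableAt (by simp)
      have h4 : HasFDerivAt (fun x ↦ fderiv ℂ T x w)
          ((ContinuousLinearMap.apply ℂ F w).comp (fderiv ℂ (fderiv ℂ T) z)) z :=
        (ContinuousLinearMap.apply ℂ F w).hasFDerivAt.comp z h3.hasFDerivAt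
      have h5 := h4.restrictScalars ℝ
      have h6 := HasFDerivAt.comp_hasDerivAt (x := (0 : ℝ)) (f := fun t : ℝ ↦ z + t • w)
        (l := fun x ↦ fderiv ℂ T x w) (by simpa using h5) (hl 0)
      exact h6
  refine ⟨_, key w, ?_⟩
  convert key (Complex.I • w) using 1
  · simp
  · simp only [map_smul, _root_.smul_apply, smul_smul]
    simp

end HasTwoDerivs

/-! ### The Levi form -/

variable {d e : ℕ}

/-- Reduces Levi forms to one-variable calculus on two real lines: by uniqueness, second derivatives
computed in any way are the Hessian terms. -/
theorem leviForm_eq {f : CC d → ℝ} {z ξ : CC d} (hf : ContDiffAt ℝ 2 f z) {a b a' b' : ℝ}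
    (h : HasTwoDerivs (fun t : ℝ ↦ f (z + t • ξ)) a b)
    (h' : HasTwoDerivs (fun t : ℝ ↦ f (z + t • (Complex.I • ξ))) a' b') :
    leviForm f z ξ = (b + b') / 4 := by
  rw [leviForm, ((HasTwoDerivs.of_contDiffAt hf ξ).unique h).2,
    ((HasTwoDerivs.of_contDiffAt hf _).unique h').2]

theorem leviForm_congr {f g : CC d → ℝ} {z : CC d} (h : f =ᶠ[𝓝 z] g) (ξ : CC d) :
    leviForm f z ξ = leviForm g z ξ := by
  rw [leviForm, leviForm, h.fderiv.fderiv_eq]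

theorem leviForm_smul_vec (f : CC d → ℝ) (z : CC d) (c : ℝ) (ξ : CC d) :
    leviForm f z (c • ξ) = c ^ 2 * leviForm f z ξ := by
  rw [leviForm, leviForm, smul_comm]
  simp only [map_smul, _root_.smul_apply, smul_eq_mul]
  ring

theorem leviForm_const_mul {f : CC d → ℝ} {z : CC d} (hf : ContDiffAt ℝ 2 f z) (c : ℝ)
    (ξ : CC d) : leviForm (fun w ↦ c * f w) z ξ = c * leviForm f z ξ := by
  rw [leviForm_eq (contDiffAt_const.mul hf)
    ((HasTwoDerivs.of_contDiffAt hf ξ).const_mul c) ((HasTwoDerivs.of_contDiffAt hf _).const_mul c),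
    leviForm]
  ring

theorem leviForm_add {f g : CC d → ℝ} {z : CC d} (hf : ContDiffAt ℝ 2 f z)
    (hg : ContDiffAt ℝ 2 g z) (ξ : CC d) :
    leviForm (fun w ↦ f w + g w) z ξ = leviForm f z ξ + leviForm g z ξ := by
  have key : ∀ w, HasTwoDerivs (fun t : ℝ ↦ f (z + t • w) + g (z + t • w)) _ _ := fun w ↦ by
    simpa [Fin.sum_univ_two] using HasTwoDerivs.sum (Finset.univ (α := Fin 2))
      (f := ![fun t : ℝ ↦ f (z + t • w), fun t : ℝ ↦ g (z + t • w)])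
      (a := ![_, _]) (b := ![_, _]) (by
        intro i _
        fin_cases i
        · exact HasTwoDerivs.of_contDiffAt hf w
        · exact HasTwoDerivs.of_contDiffAt hg w)
  rw [leviForm_eq (hf.add hg) (key _) (key _), leviForm, leviForm]
  ring

theorem leviForm_sub {f g : CC d → ℝ} {z : CC d} (hf : ContDiffAt ℝ 2 f z)
    (hg : ContDiffAt ℝ 2 g z) (ξ : CC d) :
    leviForm (fun w ↦ f w - g w) z ξ = leviForm f z ξ - leviForm g z ξ := by
  have := leviForm_add hf ((contDiffAt_const (c := (-1 : ℝ))).mul hg) ξ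
  rw [leviForm_const_mul hg] at this
  rw [show (fun w ↦ f w - g w) = fun w ↦ f w + -1 * g w by ext; ring, this]
  ring

/-- The Levi form is invariant under holomorphic changes of coordinates. -/
theorem leviForm_comp {f : CC e → ℝ} {T : CC d → CC e} {z : CC d} (hf : ContDiffAt ℝ 2 f (T z))
    (hT : ContDiffAt ℂ 2 T z) (ξ : CC d) :
    leviForm (fun w ↦ f (T w)) z ξ = leviForm f (T z) (fderiv ℂ T z ξ) := by
  obtain ⟨b, h₁, h₂⟩ := HasTwoDerivs.of_holomorphic hT ξ
  have h₃ := h₁.comp (f := f) (by simpa using hf)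
  have h₄ := h₂.comp (f := f) (by simpa using hf)
  have hc : ContDiffAt ℝ 2 (fun w ↦ f (T w)) z := ContDiffAt.comp z hf (hT.restrict_scalars ℝ)
  rw [leviForm_eq hc h₃ h₄, leviForm]
  -- The contributions `Df(b)` and `Df(-b)` of the second derivative of `T` cancel; this is where
  -- holomorphy enters.
  simp only [zero_smul, add_zero, map_neg]
  ring

/-- The Levi form of `log ‖F‖²`, for `F` holomorphic. -/
theorem leviForm_log_norm_sq {E : Type*} [NormedAddCommGroup E] [InnerProductSpace ℂ E]
    {F : CC d → E} {z : CC d} (hF : ContDiffAt ℂ 2 F z) (h0 : F z ≠ 0) (ξ : CC d) :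
    leviForm (fun w ↦ Real.log (‖F w‖ ^ 2)) z ξ =
      (‖F z‖ ^ 2 * ‖fderiv ℂ F z ξ‖ ^ 2 - ‖inner ℂ (F z) (fderiv ℂ F z ξ)‖ ^ 2) / ‖F z‖ ^ 4 := by
  let _ : NormedSpace ℝ E := NormedSpace.complexToReal
  let _ : InnerProductSpace ℝ E := InnerProductSpace.rclikeToReal ℂ E
  obtain ⟨b, h₁, h₂⟩ := HasTwoDerivs.of_holomorphic hF ξ
  have hne : ‖F z‖ ^ 2 ≠ 0 := by simpa using h0
  have hs : ContDiffAt ℝ 2 (fun w ↦ Real.log (‖F w‖ ^ 2)) z :=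
    ((hF.restrict_scalars ℝ).norm_sq ℝ).log hne
  have h₃ := h₁.norm_sq.log (by simpa using h0)
  have h₄ := h₂.norm_sq.log (by simpa using h0)
  rw [leviForm_eq hs h₃ h₄]
  set a := fderiv ℂ F z ξ
  have e1 : ‖inner ℂ (F z) a‖ ^ 2 = (inner ℂ (F z) a).re ^ 2 + (inner ℂ (F z) a).im ^ 2 := by
    rw [Complex.sq_norm, Complex.normSq_apply]; ring
  have hne' : ‖F z‖ ≠ 0 := by simpa using h0
  simp only [zero_smul, add_zero, inner_smul_right, inner_neg_right, norm_smul, Complex.norm_I,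
    Complex.mul_re, Complex.neg_re, Complex.I_re, Complex.I_im, e1]
  field_simp
  ring

/-- In a one-dimensional target Cauchy–Schwarz is an equality, so the numerator of
`leviForm_log_norm_sq` vanishes. -/
theorem leviForm_log_norm_sq_eq_zero {G : CC d → ℂ} {z : CC d} (hG : ContDiffAt ℂ 2 G z)
    (h0 : G z ≠ 0) (ξ : CC d) : leviForm (fun w ↦ Real.log (‖G w‖ ^ 2)) z ξ = 0 := by
  rw [leviForm_log_norm_sq hG h0]
  simp only [RCLike.inner_apply, norm_mul, RCLike.norm_conj]
  ring

/-- Where `a` does not vanish, `4 a Levi(a) - Levi(a²)` equals `a² Levi(log a²)`, so the left side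
is the average of the `Levi(log a_i²)` with weights `a_i²`. Written without dividing by `a_i`, it
allows cut-off functions with zeros. The difference of the two sides is, in each of the real
directions `ξ` and `I • ξ`, a Cauchy–Schwarz defect between the `a_i` and their derivatives. -/
theorem leviForm_log_sum_sq_ge {ι : Type*} (s : Finset ι) {a : ι → CC d → ℝ} {z : CC d}
    (ha : ∀ i ∈ s, ContDiffAt ℝ 2 (a i) z) (h0 : 0 < ∑ i ∈ s, a i z ^ 2) (ξ : CC d) :
    (∑ i ∈ s, (4 * a i z * leviForm (a i) z ξ - leviForm (fun w ↦ a i w ^ 2) z ξ)) /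
      (∑ i ∈ s, a i z ^ 2) ≤ leviForm (fun w ↦ Real.log (∑ i ∈ s, a i w ^ 2)) z ξ := by
  have hsq : ∀ i ∈ s, ∀ w, HasTwoDerivs (fun t : ℝ ↦ a i (z + t • w) ^ 2) _ _ := fun i hi w ↦ by
    have h := HasTwoDerivs.of_contDiffAt (ha i hi) w
    simpa only [pow_two] using h.mul h
  have hlog : ∀ w, HasTwoDerivs (fun t : ℝ ↦ Real.log (∑ i ∈ s, a i (z + t • w) ^ 2)) _ _ :=
    fun w ↦ (HasTwoDerivs.sum s (f := fun i t ↦ a i (z + t • w) ^ 2)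
      (fun i hi ↦ hsq i hi w)).log (by simpa using h0.ne')
  have hS : ContDiffAt ℝ 2 (fun w ↦ ∑ i ∈ s, a i w ^ 2) z :=
    ContDiffAt.sum fun i hi ↦ (ha i hi).pow 2
  rw [leviForm_eq (hS.log h0.ne') (hlog ξ) (hlog _)]
  have e1 : ∀ i ∈ s, leviForm (fun w ↦ a i w ^ 2) z ξ = _ := fun i hi ↦
    leviForm_eq ((ha i hi).pow 2) (hsq i hi ξ) (hsq i hi _)
  rw [Finset.sum_congr rfl fun i hi ↦ by rw [e1 i hi]]
  simp only [leviForm, zero_smul, add_zero]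
  have key : ∀ w : CC d, (∑ i ∈ s, (2 * a i z * fderiv ℝ (fderiv ℝ (a i)) z w w -
      2 * (fderiv ℝ (a i) z w) ^ 2)) / (∑ i ∈ s, a i z ^ 2) ≤
      ((∑ i ∈ s, (fderiv ℝ (fderiv ℝ (a i)) z w w * a i z +
        2 * fderiv ℝ (a i) z w * fderiv ℝ (a i) z w + a i z * fderiv ℝ (fderiv ℝ (a i)) z w w)) *
        (∑ i ∈ s, a i z ^ 2) -
        (∑ i ∈ s, (fderiv ℝ (a i) z w * a i z + a i z * fderiv ℝ (a i) z w)) ^ 2) /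
        (∑ i ∈ s, a i z ^ 2) ^ 2 := by
    intro w
    have hCS := Finset.sum_mul_sq_le_sq_mul_sq s (fun i ↦ a i z) (fun i ↦ fderiv ℝ (a i) z w)
    have t1 : ∑ i ∈ s, (fderiv ℝ (a i) z w * a i z + a i z * fderiv ℝ (a i) z w) =
        2 * ∑ i ∈ s, a i z * fderiv ℝ (a i) z w := by
      rw [Finset.mul_sum]; exact Finset.sum_congr rfl fun i _ ↦ by ring
    have t2 : ∑ i ∈ s, (fderiv ℝ (fderiv ℝ (a i)) z w w * a i z +
        2 * fderiv ℝ (a i) z w * fderiv ℝ (a i) z w + a i z * fderiv ℝ (fderiv ℝ (a i)) z w w) =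
        ∑ i ∈ s, (2 * a i z * fderiv ℝ (fderiv ℝ (a i)) z w w - 2 * (fderiv ℝ (a i) z w) ^ 2) +
        4 * ∑ i ∈ s, (fderiv ℝ (a i) z w) ^ 2 := by
      rw [Finset.mul_sum, ← Finset.sum_add_distrib]
      exact Finset.sum_congr rfl fun i _ ↦ by ring
    rw [t1, t2, div_le_div_iff₀ h0 (by positivity)]
    nlinarith [mul_le_mul_of_nonneg_left hCS h0.le]
  have k1 := key ξ
  have k2 := key (Complex.I • ξ)
  refine le_trans (le_of_eq ?_) (div_le_div_of_nonneg_right (add_le_add k1 k2)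
    (by norm_num : (0 : ℝ) ≤ 4))
  rw [← add_div, ← Finset.sum_add_distrib, div_right_comm]
  congr 1
  rw [Finset.sum_div]
  exact Finset.sum_congr rfl fun i _ ↦ by ring

/-- Formally `log (θ exp(v/2))² = log θ² + v`, so no product of first derivatives of `θ` and `v`
appears. The gluing error therefore depends on `θ` alone, however large the derivatives of `v` are.
-/
theorem leviForm_mul_exp {θ v : CC d → ℝ} {z : CC d} (hθ : ContDiffAt ℝ 2 θ z)
    (hv : ContDiffAt ℝ 2 v z) (ξ : CC d) :
    4 * (θ z * Real.exp (v z / 2)) * leviForm (fun w ↦ θ w * Real.exp (v w / 2)) z ξ -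
        leviForm (fun w ↦ (θ w * Real.exp (v w / 2)) ^ 2) z ξ =
      Real.exp (v z) * (4 * θ z * leviForm θ z ξ - leviForm (fun w ↦ θ w ^ 2) z ξ +
        θ z ^ 2 * leviForm v z ξ) := by
  have h1 : ∀ w, HasTwoDerivs (fun t : ℝ ↦ θ (z + t • w) * Real.exp (v (z + t • w) / 2)) _ _ :=
    fun w ↦ (HasTwoDerivs.of_contDiffAt hθ w).mul (by
      simpa only [div_eq_inv_mul] using
        ((HasTwoDerivs.of_contDiffAt hv w).const_mul 2⁻¹).exp)
  have h2 : ∀ w, HasTwoDerivs (fun t : ℝ ↦ (θ (z + t • w) * Real.exp (v (z + t • w) / 2)) ^ 2)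
      _ _ := fun w ↦ by simpa only [pow_two] using (h1 w).mul (h1 w)
  have h3 : ∀ w, HasTwoDerivs (fun t : ℝ ↦ θ (z + t • w) ^ 2) _ _ := fun w ↦ by
    have h := HasTwoDerivs.of_contDiffAt hθ w
    simpa only [pow_two] using h.mul h
  have hE : ContDiffAt ℝ 2 (fun w ↦ θ w * Real.exp (v w / 2)) z := hθ.mul (hv.div_const 2).exp
  rw [leviForm_eq hE (h1 _) (h1 _), leviForm_eq (hE.pow 2) (h2 _) (h2 _),
    leviForm_eq (hθ.pow 2) (h3 _) (h3 _)]
  have hx : Real.exp (v z) = Real.exp (2⁻¹ * v z) ^ 2 := by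
    rw [← Real.exp_nat_mul]; congr 1; push_cast; ring
  simp only [leviForm, zero_smul, add_zero, hx, div_eq_inv_mul (v z)]
  ring

end LeviCalculus

section Regularization

/-! ### Smooth plurisubharmonic functions and regularization -/

variable {d : ℕ}

theorem two_le_infty : (2 : ℕ∞ω) ≤ ∞ :=
  WithTop.coe_le_coe.2 le_top

theorem contDiff_fderiv_apply {f : CC d → ℝ} (hf : ContDiff ℝ ∞ f) (ξ : CC d) :
    ContDiff ℝ ∞ fun z ↦ fderiv ℝ f z ξ :=
  (hf.fderiv_right (m := ∞) (by simp)).clm_apply contDiff_const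

theorem fderiv_fderiv_apply {f : CC d → ℝ} (hf : ContDiff ℝ ∞ f) (z ξ : CC d) :
    fderiv ℝ (fun z ↦ fderiv ℝ f z ξ) z ξ = fderiv ℝ (fderiv ℝ f) z ξ ξ := by
  have h : DifferentiableAt ℝ (fderiv ℝ f) z :=
    (hf.fderiv_right (m := ∞) (by simp)).differentiable (by simp) z
  rw [fderiv_clm_apply h (differentiableAt_const _)]
  simp

theorem leviForm_eq_zero_of_notMem_tsupport {f : CC d → ℝ} {z : CC d} (hz : z ∉ tsupport f)
    (ξ : CC d) : leviForm f z ξ = 0 := by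
  rw [leviForm_congr (notMem_tsupport_iff_eventuallyEq.1 hz), leviForm]
  simp

/-- Two integrations by parts in each of the directions `ξ` and `I • ξ`. -/
theorem integral_mul_leviForm {w φ : CC d → ℝ} (hw : ContDiff ℝ ∞ w) (hφ : ContDiff ℝ ∞ φ)
    (hc : HasCompactSupport φ) (ξ : CC d) :
    ∫ z, w z * leviForm φ z ξ = ∫ z, leviForm w z ξ * φ z := by
  have hcD : ∀ (ξ : CC d), HasCompactSupport fun z ↦ fderiv ℝ φ z ξ := fun ξ ↦
    hc.fderiv_apply (𝕜 := ℝ) ξ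
  have key : ∀ ξ : CC d, ∫ z, w z * fderiv ℝ (fderiv ℝ φ) z ξ ξ =
      ∫ z, fderiv ℝ (fderiv ℝ w) z ξ ξ * φ z := by
    intro ξ
    have hwD := contDiff_fderiv_apply hw ξ
    have hφD := contDiff_fderiv_apply hφ ξ
    have hwDD := contDiff_fderiv_apply hwD ξ
    have hφDD := contDiff_fderiv_apply hφD ξ
    simp_rw [← fderiv_fderiv_apply hφ, ← fderiv_fderiv_apply hw]
    have i1 : ∀ {f g : CC d → ℝ}, Continuous f → Continuous g → HasCompactSupport g →
        Integrable fun z ↦ f z * g z := fun hf hg h ↦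
      (hf.mul hg).integrable_of_hasCompactSupport h.mul_left
    rw [integral_mul_fderiv_eq_neg_fderiv_mul_of_integrable
        (i1 hwD.continuous hφD.continuous (hcD ξ))
        (i1 hw.continuous hφDD.continuous ((hcD ξ).fderiv_apply (𝕜 := ℝ) ξ))
        (i1 hw.continuous hφD.continuous (hcD ξ))
        (fun x _ ↦ hw.differentiable (by simp) x) (fun x _ ↦ hφD.differentiable (by simp) x),
      integral_mul_fderiv_eq_neg_fderiv_mul_of_integrable
        (i1 hwDD.continuous hφ.continuous hc)
        (i1 hwD.continuous hφD.continuous (hcD ξ))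
        (i1 hwD.continuous hφ.continuous hc)
        (fun x _ ↦ hwD.differentiable (by simp) x) (fun x _ ↦ hφ.differentiable (by simp) x),
      neg_neg]
  have cont : ∀ {f : CC d → ℝ}, ContDiff ℝ ∞ f → ∀ ξ, Continuous fun z ↦
      fderiv ℝ (fderiv ℝ f) z ξ ξ := fun hf ξ ↦ by
    simp_rw [← fderiv_fderiv_apply hf]
    exact (contDiff_fderiv_apply (contDiff_fderiv_apply hf ξ) ξ).continuous
  have i1 : ∀ ξ, Integrable fun z ↦ w z * fderiv ℝ (fderiv ℝ φ) z ξ ξ := fun ξ ↦ by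
    refine (hw.continuous.mul (cont hφ ξ)).integrable_of_hasCompactSupport
      (HasCompactSupport.mul_left ?_)
    simp_rw [← fderiv_fderiv_apply hφ]
    exact (hcD ξ).fderiv_apply (𝕜 := ℝ) ξ
  have i2 : ∀ ξ, Integrable fun z ↦ fderiv ℝ (fderiv ℝ w) z ξ ξ * φ z := fun ξ ↦
    ((cont hw ξ).mul hφ.continuous).integrable_of_hasCompactSupport hc.mul_left
  calc ∫ z, w z * leviForm φ z ξ
      = ∫ z, (w z * fderiv ℝ (fderiv ℝ φ) z ξ ξ +
          w z * fderiv ℝ (fderiv ℝ φ) z (Complex.I • ξ) (Complex.I • ξ)) / 4 := by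
        simp only [leviForm]; congr 1; ext z; ring
    _ = ∫ z, (fderiv ℝ (fderiv ℝ w) z ξ ξ * φ z +
          fderiv ℝ (fderiv ℝ w) z (Complex.I • ξ) (Complex.I • ξ) * φ z) / 4 := by
        rw [integral_div, integral_div, integral_add (i1 _) (i1 _), integral_add (i2 _) (i2 _),
          key, key]
    _ = _ := by simp only [leviForm]; congr 1; ext z; ring

/-- There is a smooth function with compact support in the open set `V`, which is `1` near the
compact set `K`. -/
theorem exists_contDiff_one_near {K V : Set (CC d)} (hK : IsCompact K) (hV : IsOpen V)
    (hKV : K ⊆ V) : ∃ χ : CC d → ℝ, ContDiff ℝ ∞ χ ∧ tsupport χ ⊆ V ∧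
      ∀ z ∈ K, χ =ᶠ[𝓝 z] fun _ ↦ 1 := by
  obtain ⟨K₁, hK₁, hKK₁, hK₁V⟩ := exists_compact_between hK hV hKV
  obtain ⟨K₂, hK₂, hKK₂, hK₂V⟩ := exists_compact_between hK₁ hV hK₁V
  obtain ⟨χ, hχ, -, hsupp, hone⟩ := exists_contMDiff_support_eq_eq_one_iff 𝓘(ℝ, CC d) (n := ⊤)
    (isOpen_interior (s := K₂)) hK₁.isClosed hKK₂
  refine ⟨χ, contMDiff_iff_contDiff.1 hχ, ?_, fun z hz ↦ ?_⟩
  · refine (closure_minimal ?_ hK₂.isClosed).trans hK₂V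
    rw [hsupp]
    exact interior_subset
  · filter_upwards [isOpen_interior.mem_nhds (hKK₁ hz)] with y hy
    exact (hone y).1 (interior_subset hy)

/-- A smooth function with non-negative Levi form is plurisubharmonic in the sense of currents. -/
theorem DdcNonnegOn.of_leviForm_nonneg {V : Set (CC d)} (hV : IsOpen V) {u : CC d → ℝ}
    (hu : ∀ z ∈ V, ContDiffAt ℝ ∞ u z) (hl : ∀ z ∈ V, ∀ ξ, 0 ≤ leviForm u z ξ) :
    DdcNonnegOn V u := by
  intro φ hφ hc hsupp hpos ξ
  -- `u` is smooth only on `V`, and the integration by parts needs a globally smooth function: `χ u`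
  -- is one, and equals `u` near the support of `φ`.
  obtain ⟨χ, hχ, hχV, hone⟩ := exists_contDiff_one_near hc hV hsupp
  have hw : ContDiff ℝ ∞ fun z ↦ χ z * u z := by
    rw [contDiff_iff_contDiffAt]
    intro z
    by_cases hz : z ∈ tsupport χ
    · exact hχ.contDiffAt.mul (hu z (hχV hz))
    · refine (contDiffAt_const (c := (0 : ℝ))).congr_of_eventuallyEq ?_
      filter_upwards [notMem_tsupport_iff_eventuallyEq.1 hz] with y hy
      simp [hy]
  have hev : ∀ z ∈ tsupport φ, (fun z ↦ χ z * u z) =ᶠ[𝓝 z] u := fun z hz ↦ by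
    filter_upwards [hone z hz] with y hy
    simp [hy]
  have e1 : ∫ z, u z * leviForm φ z ξ = ∫ z, (χ z * u z) * leviForm φ z ξ := by
    congr 1
    ext z
    by_cases hz : z ∈ tsupport φ
    · rw [(hev z hz).eq_of_nhds]
    · rw [leviForm_eq_zero_of_notMem_tsupport hz, mul_zero, mul_zero]
  rw [e1, integral_mul_leviForm hw hφ hc]
  refine integral_nonneg fun z ↦ ?_
  by_cases hz : z ∈ tsupport φ
  · rw [leviForm_congr (hev z hz)]
    exact mul_nonneg (hl z (hsupp hz) ξ) (hpos z)
  · simp [image_eq_zero_of_notMem_tsupport hz]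

theorem fderiv_convolution_apply {f ρ : CC d → ℝ} (hf : LocallyIntegrable f)
    (hρ : ContDiff ℝ ∞ ρ) (hc : HasCompactSupport ρ) (z ξ : CC d) :
    fderiv ℝ (convolution f ρ (ContinuousLinearMap.lsmul ℝ ℝ).flip volume) z ξ =
      convolution f (fun w ↦ fderiv ℝ ρ w ξ) (ContinuousLinearMap.lsmul ℝ ℝ).flip volume z := by
  rw [(hc.hasFDerivAt_convolution_right _ hf (hρ.of_le (by simp)) z).fderiv,
    convolution_precompR_apply _ hf (hc.fderiv (𝕜 := ℝ))
      (hρ.fderiv_right (m := ∞) (by simp)).continuous]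

theorem leviForm_convolution {f ρ : CC d → ℝ} (hf : LocallyIntegrable f) (hρ : ContDiff ℝ ∞ ρ)
    (hc : HasCompactSupport ρ) (z ξ : CC d) :
    leviForm (convolution f ρ (ContinuousLinearMap.lsmul ℝ ℝ).flip volume) z ξ =
      ∫ w, f w * leviForm ρ (z - w) ξ := by
  have hρD := contDiff_fderiv_apply hρ
  have hcD : ∀ ξ : CC d, HasCompactSupport fun w ↦ fderiv ℝ ρ w ξ := fun ξ ↦
    hc.fderiv_apply (𝕜 := ℝ) ξ
  have h3 : ∀ ξ, fderiv ℝ (fderiv ℝ (convolution f ρ (ContinuousLinearMap.lsmul ℝ ℝ).flip volume))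
      z ξ ξ = ∫ w, f w * fderiv ℝ (fderiv ℝ ρ) (z - w) ξ ξ := by
    intro ξ
    rw [← fderiv_fderiv_apply (hc.contDiff_convolution_right _ hf hρ)]
    simp_rw [fderiv_convolution_apply hf hρ hc]
    rw [fderiv_convolution_apply hf (hρD ξ) (hcD ξ)]
    simp [convolution_def, mul_comm, fderiv_fderiv_apply hρ]
  have hi : ∀ ξ, Integrable fun w ↦ f w * fderiv ℝ (fderiv ℝ ρ) (z - w) ξ ξ := fun ξ ↦ by
    have := ((hcD ξ).fderiv_apply (𝕜 := ℝ) ξ).convolutionExists_right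
      (ContinuousLinearMap.lsmul ℝ ℝ : ℝ →L[ℝ] ℝ →L[ℝ] ℝ).flip hf
      (contDiff_fderiv_apply (hρD ξ) ξ).continuous z
    simpa [ConvolutionExistsAt, mul_comm, fderiv_fderiv_apply hρ] using this
  rw [leviForm, h3, h3, ← integral_add (hi _) (hi _), ← integral_div]
  congr 1
  ext w
  simp only [leviForm]
  ring

/-- The reflection contributes `(-1)² = 1`. This identifies the differentiated kernel of a
convolution with the Levi form of the test function `w ↦ ρ (z - w)`. -/
theorem leviForm_comp_sub_left {f : CC d → ℝ} (hf : ContDiff ℝ ∞ f) (a z ξ : CC d) :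
    leviForm (fun w ↦ f (a - w)) z ξ = leviForm f (a - z) ξ := by
  have hT : ContDiff ℂ 2 fun w : CC d ↦ a - w := contDiff_const.sub contDiff_id
  rw [leviForm_comp (T := fun w ↦ a - w) (hf.contDiffAt.of_le two_le_infty) hT.contDiffAt]
  have : fderiv ℂ (fun w : CC d ↦ a - w) z ξ = (-1 : ℝ) • ξ := by
    rw [fderiv_const_sub]; simp
  rw [this, leviForm_smul_vec]
  simp

/-- A continuous function that is plurisubharmonic in the sense of currents on an open set is, near
a compact subset, a uniform limit of smooth functions with non-negative Levi form. -/
theorem DdcNonnegOn.exists_smooth_approx {V K : Set (CC d)} (hV : IsOpen V) (hK : IsCompact K)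
    (hKV : K ⊆ V) {u : CC d → ℝ} (hu : ContinuousOn u V) (hpsh : DdcNonnegOn V u) {ε : ℝ}
    (hε : 0 < ε) : ∃ v : CC d → ℝ, ContDiff ℝ ∞ v ∧ (∀ z ∈ K, |v z - u z| ≤ ε) ∧
      ∀ z ∈ K, ∀ ξ, 0 ≤ leviForm v z ξ := by
  obtain ⟨δ, hδ, hδV⟩ := hK.exists_cthickening_subset_open hV hKV
  have hK' : IsCompact (Metric.cthickening δ K) := hK.cthickening
  set K' := Metric.cthickening δ K
  have huc := hK'.uniformContinuousOn_of_continuous (hu.mono hδV)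
  rw [Metric.uniformContinuousOn_iff_le] at huc
  obtain ⟨η, hη, huη⟩ := huc ε hε
  -- A mollifier of radius `r < δ` sees only points of `K' ⊆ V` from `K`; `r ≤ η` limits the
  -- variation of `u` there to `ε`.
  set r := min δ η / 2
  have hr : 0 < r := by positivity
  have hrδ : r < δ := (half_lt_self (by positivity)).trans_le (min_le_left _ _)
  have hrη : r ≤ η := (half_le_self (by positivity)).trans (min_le_right _ _)
  let b : ContDiffBump (0 : CC d) := ⟨r / 2, r, by positivity, by linarith⟩
  set ρ := b.normed (volume : Measure (CC d))
  have hρ : ContDiff ℝ ∞ ρ := b.contDiff_normed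
  have hρc : HasCompactSupport ρ := b.hasCompactSupport_normed
  -- The truncation is integrable on the whole space and does not affect the convolution at points
  -- of `K`.
  set f : CC d → ℝ := K'.indicator u
  have hfi : Integrable f := by
    rw [integrable_indicator_iff hK'.isClosed.measurableSet]
    exact (hu.mono hδV).integrableOn_compact hK'
  have hball : ∀ z ∈ K, Metric.closedBall z r ⊆ K' := fun z hz y hy ↦
    Metric.mem_cthickening_of_dist_le y z δ K hz ((Metric.mem_closedBall.1 hy).trans hrδ.le)
  refine ⟨convolution f ρ (ContinuousLinearMap.lsmul ℝ ℝ).flip volume,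
    hρc.contDiff_convolution_right _ hfi.locallyIntegrable hρ, fun z hz ↦ ?_, fun z hz ξ ↦ ?_⟩
  · have hzK' : z ∈ K' := hball z hz (Metric.mem_closedBall_self hr.le)
    rw [convolution_flip, ← Real.dist_eq, ← indicator_of_mem hzK' u]
    refine ContDiffBump.dist_normed_convolution_le hfi.aestronglyMeasurable fun y hy ↦ ?_
    have hy' := Metric.ball_subset_closedBall hy
    simp only [indicator_of_mem hzK', indicator_of_mem (hball z hz hy'), f]
    exact huη _ (hball z hz hy') _ hzK' ((Metric.mem_closedBall.1 hy').trans hrη)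
  · rw [leviForm_convolution hfi.locallyIntegrable hρ hρc]
    have hsupp : tsupport (fun w ↦ ρ (z - w)) ⊆ Metric.closedBall z r := by
      refine closure_minimal (fun w hw ↦ ?_) Metric.isClosed_closedBall
      have h : z - w ∈ Function.support ρ := hw
      rw [b.support_normed_eq, mem_ball_zero_iff] at h
      rw [mem_closedBall_iff_norm']
      exact h.le
    have hρz : ContDiff ℝ ∞ fun w ↦ ρ (z - w) := hρ.comp (contDiff_const.sub contDiff_id)
    -- The translated kernel is an admissible test function, so positivity of the current is the
    -- sign of the Levi form of the convolution.
    have h := hpsh (fun w ↦ ρ (z - w)) hρz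
      (HasCompactSupport.of_support_subset_isCompact (isCompact_closedBall z r)
        (subset_closure.trans hsupp)) (hsupp.trans ((hball z hz).trans hδV))
      (fun w ↦ b.nonneg_normed _) ξ
    refine h.trans_eq (integral_congr_ae (.of_forall fun w ↦ ?_))
    by_cases hw : w ∈ K'
    · simp only [f, indicator_of_mem hw, leviForm_comp_sub_left hρ]
    · have h0 : leviForm (fun w ↦ ρ (z - w)) w ξ = 0 :=
        leviForm_eq_zero_of_notMem_tsupport (fun h ↦ hw (hball z hz (hsupp h))) ξ
      simp only [h0, f, indicator_of_notMem hw, mul_zero, zero_mul]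

end Regularization

section KahlerPotential

/-! ### The Levi form in charts of a complex manifold -/

variable {d : ℕ} {X : Type*} [TopologicalSpace X]

/-- The Levi form at the point `x` of a function on a complex manifold, read in the chart `c`. -/
noncomputable def chartLevi (c : OpenPartialHomeomorph X (CC d)) (f : X → ℝ) (x : X)
    (ξ : CC d) : ℝ :=
  leviForm (fun z ↦ f (c.symm z)) (c x) ξ

theorem chartLevi_congr {c : OpenPartialHomeomorph X (CC d)} {f g : X → ℝ} {x : X}
    (hx : x ∈ c.source) (h : f =ᶠ[𝓝 x] g) (ξ : CC d) : chartLevi c f x ξ = chartLevi c g x ξ := by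
  refine leviForm_congr ?_ ξ
  have hc : Tendsto c.symm (𝓝 (c x)) (𝓝 x) := by
    simpa [ContinuousAt, hx] using c.symm.continuousAt (c.map_source hx)
  exact hc.eventually h

variable [ChartedSpace (CC d) X]

/-! ### Local potentials of a Kähler form -/

/-- The functions `p i` on the open sets `U i`, which cover `X`, are local potentials of
a Kähler form on `X`. -/
structure IsKahlerPotential {ι : Type*} (U : ι → Set X) (p : ι → X → ℝ) : Prop where
  isOpen : ∀ i, IsOpen (U i)
  cover : ∀ x, ∃ i, x ∈ U i
  smooth : ∀ i, ∀ x ∈ U i, ContMDiffAt 𝓘(ℝ, CC d) 𝓘(ℝ, ℝ) ∞ (p i) x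
  compat : ∀ i j x, x ∈ U i → x ∈ U j → ∀ c ∈ atlas (CC d) X, x ∈ c.source → ∀ ξ : CC d,
    chartLevi c (p i) x ξ = chartLevi c (p j) x ξ
  pos : ∀ i, ∀ x ∈ U i, ∀ c ∈ atlas (CC d) X, x ∈ c.source → ∀ ξ : CC d, ξ ≠ 0 →
    0 < chartLevi c (p i) x ξ

theorem IsKahlerPotential.nonneg {ι : Type*} {U : ι → Set X} {p : ι → X → ℝ}
    (hp : IsKahlerPotential (d := d) U p) {i : ι} {x : X}
    (hx : x ∈ U i) {c : OpenPartialHomeomorph X (CC d)} (hc : c ∈ atlas (CC d) X)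
    (hxc : x ∈ c.source) (ξ : CC d) : 0 ≤ chartLevi c (p i) x ξ := by
  rcases eq_or_ne ξ 0 with rfl | hξ
  · simp [chartLevi, leviForm]
  · exact (hp.pos i x hx c hc hxc ξ hξ).le

/-! ### Real smoothness on complex manifolds -/

/-- A complex manifold is a smooth real manifold. -/
theorem isManifold_real [IsManifold 𝓘(ℂ, CC d) ω X] : IsManifold 𝓘(ℝ, CC d) ∞ X := by
  refine isManifold_of_contDiffOn _ _ _ fun e e' he he' ↦ ?_
  have h := ((contDiffGroupoid ω 𝓘(ℂ, CC d)).compatible he he')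
  rw [contDiffGroupoid, mem_groupoid_of_pregroupoid] at h
  have h1 : ContDiffOn ℂ ω (e.symm ≫ₕ e') (e.symm ≫ₕ e').source := by
    simpa [contDiffPregroupoid] using h.1
  simpa using (h1.restrict_scalars ℝ).of_le le_top

theorem contDiffAt_comp_symm_real [IsManifold 𝓘(ℂ, CC d) ω X] {E : Type*} [NormedAddCommGroup E]
    [NormedSpace ℝ E] {f : X → E} {x : X}
    (hf : ContMDiffAt 𝓘(ℝ, CC d) 𝓘(ℝ, E) ∞ f x) {c : OpenPartialHomeomorph X (CC d)}
    (hc : c ∈ atlas (CC d) X) (hx : x ∈ c.source) :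
    ContDiffAt ℝ ∞ (fun z ↦ f (c.symm z)) (c x) := by
  have := isManifold_real (d := d) (X := X)
  have h := (contMDiffOn_symm_of_mem_maximalAtlas (I := 𝓘(ℝ, CC d)) (n := ∞)
    (IsManifold.subset_maximalAtlas hc)).contMDiffAt (c.open_target.mem_nhds (c.map_source hx))
  refine contMDiffAt_iff_contDiffAt.1 (ContMDiffAt.comp (c x) (I' := 𝓘(ℝ, CC d)) ?_ h)
  rwa [c.left_inv hx]

theorem contDiffAt_comp_symm_complex [IsManifold 𝓘(ℂ, CC d) ω X] {E : Type*} [NormedAddCommGroup E]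
    [NormedSpace ℂ E] {f : X → E} {x : X}
    (hf : ContMDiffAt 𝓘(ℂ, CC d) 𝓘(ℂ, E) ω f x) {c : OpenPartialHomeomorph X (CC d)}
    (hc : c ∈ atlas (CC d) X) (hx : x ∈ c.source) :
    ContDiffAt ℂ ω (fun z ↦ f (c.symm z)) (c x) := by
  have h := (contMDiffOn_symm_of_mem_maximalAtlas (I := 𝓘(ℂ, CC d)) (n := ω)
    (IsManifold.subset_maximalAtlas hc)).contMDiffAt (c.open_target.mem_nhds (c.map_source hx))
  refine contMDiffAt_iff_contDiffAt.1 (ContMDiffAt.comp (c x) (I' := 𝓘(ℂ, CC d)) ?_ h)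
  rwa [c.left_inv hx]

theorem contMDiffAt_chart_real [IsManifold 𝓘(ℂ, CC d) ω X] {c : OpenPartialHomeomorph X (CC d)}
    (hc : c ∈ atlas (CC d) X) {x : X} (hx : x ∈ c.source) :
    ContMDiffAt 𝓘(ℝ, CC d) 𝓘(ℝ, CC d) ∞ c x := by
  have := isManifold_real (d := d) (X := X)
  exact contMDiffAt_of_mem_maximalAtlas (IsManifold.subset_maximalAtlas hc) hx

theorem contMDiffAt_comp_chart_real [IsManifold 𝓘(ℂ, CC d) ω X] {E : Type*} [NormedAddCommGroup E]
    [NormedSpace ℝ E] {g : CC d → E} {c : OpenPartialHomeomorph X (CC d)}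
    (hc : c ∈ atlas (CC d) X) {x : X} (hx : x ∈ c.source) (hg : ContDiffAt ℝ ∞ g (c x)) :
    ContMDiffAt 𝓘(ℝ, CC d) 𝓘(ℝ, E) ∞ (fun y ↦ g (c y)) x :=
  ContMDiffAt.comp x (I' := 𝓘(ℝ, CC d)) (contMDiffAt_iff_contDiffAt.2 hg)
    (contMDiffAt_chart_real hc hx)

/-- A holomorphic map is smooth in the real sense. -/
theorem contMDiffAt_real_of_complex [IsManifold 𝓘(ℂ, CC d) ω X] {E : Type*} [NormedAddCommGroup E]
    [NormedSpace ℂ E] [NormedSpace ℝ E] [IsScalarTower ℝ ℂ E] {f : X → E} {x : X}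
    (hf : ContMDiffAt 𝓘(ℂ, CC d) 𝓘(ℂ, E) ω f x) : ContMDiffAt 𝓘(ℝ, CC d) 𝓘(ℝ, E) ∞ f x := by
  have hx := mem_chart_source (CC d) x
  have h := contMDiffAt_comp_chart_real (chart_mem_atlas (CC d) x) hx
    (((contDiffAt_comp_symm_complex hf (chart_mem_atlas (CC d) x) hx).restrict_scalars ℝ).of_le
      le_top)
  refine h.congr_of_eventuallyEq ?_
  filter_upwards [(chartAt (CC d) x).open_source.mem_nhds hx] with y hy
  rw [(chartAt (CC d) x).left_inv hy]

variable [IsManifold 𝓘(ℂ, CC d) ω X]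

/-! ### Change of charts, and comparison with the Kähler form -/

theorem chartLevi_change {c c' : OpenPartialHomeomorph X (CC d)} (hc : c ∈ atlas (CC d) X)
    (hc' : c' ∈ atlas (CC d) X) {x : X} (hx : x ∈ c.source) (hx' : x ∈ c'.source) {f : X → ℝ}
    (hf : ContMDiffAt 𝓘(ℝ, CC d) 𝓘(ℝ, ℝ) ∞ f x) (ξ : CC d) :
    chartLevi c f x ξ = chartLevi c' f x (fderiv ℂ (fun z ↦ c' (c.symm z)) (c x) ξ) := by
  have hT : ContDiffAt ℂ 2 (fun z ↦ c' (c.symm z)) (c x) :=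
    (contDiffAt_comp_symm_complex (contMDiffAt_of_mem_maximalAtlas
      (IsManifold.subset_maximalAtlas hc') hx') hc hx).of_le le_top
  have hxx : c.symm (c x) = x := c.left_inv hx
  have h := leviForm_comp (f := fun z ↦ f (c'.symm z)) (T := fun z ↦ c' (c.symm z)) (z := c x)
    (by simpa only [hxx] using (contDiffAt_comp_symm_real hf hc' hx').of_le two_le_infty) hT ξ
  simp only [hxx] at h
  rw [chartLevi, chartLevi, ← h]
  refine leviForm_congr ?_ ξ
  have hcont : ContinuousAt c.symm (c x) := c.symm.continuousAt (c.map_source hx)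
  filter_upwards [hcont.preimage_mem_nhds (c'.open_source.mem_nhds (by rwa [hxx]))] with z hz
  rw [c'.left_inv hz]

theorem contDiffAt_two_comp_symm {c : OpenPartialHomeomorph X (CC d)} (hc : c ∈ atlas (CC d) X)
    {x : X} (hx : x ∈ c.source) {f : X → ℝ} (hf : ContMDiffAt 𝓘(ℝ, CC d) 𝓘(ℝ, ℝ) ∞ f x) :
    ContDiffAt ℝ 2 (fun z ↦ f (c.symm z)) (c x) :=
  (contDiffAt_comp_symm_real hf hc hx).of_le two_le_infty

theorem chartLevi_const_mul {c : OpenPartialHomeomorph X (CC d)} (hc : c ∈ atlas (CC d) X)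
    {x : X} (hx : x ∈ c.source) {f : X → ℝ} (hf : ContMDiffAt 𝓘(ℝ, CC d) 𝓘(ℝ, ℝ) ∞ f x)
    (a : ℝ) (ξ : CC d) :
    chartLevi c (fun y ↦ a * f y) x ξ = a * chartLevi c f x ξ :=
  leviForm_const_mul (contDiffAt_two_comp_symm hc hx hf) a ξ

theorem chartLevi_add {c : OpenPartialHomeomorph X (CC d)} (hc : c ∈ atlas (CC d) X)
    {x : X} (hx : x ∈ c.source) {f g : X → ℝ} (hf : ContMDiffAt 𝓘(ℝ, CC d) 𝓘(ℝ, ℝ) ∞ f x)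
    (hg : ContMDiffAt 𝓘(ℝ, CC d) 𝓘(ℝ, ℝ) ∞ g x) (ξ : CC d) :
    chartLevi c (fun y ↦ f y + g y) x ξ = chartLevi c f x ξ + chartLevi c g x ξ :=
  leviForm_add (contDiffAt_two_comp_symm hc hx hf) (contDiffAt_two_comp_symm hc hx hg) ξ

theorem chartLevi_sub {c : OpenPartialHomeomorph X (CC d)} (hc : c ∈ atlas (CC d) X)
    {x : X} (hx : x ∈ c.source) {f g : X → ℝ} (hf : ContMDiffAt 𝓘(ℝ, CC d) 𝓘(ℝ, ℝ) ∞ f x)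
    (hg : ContMDiffAt 𝓘(ℝ, CC d) 𝓘(ℝ, ℝ) ∞ g x) (ξ : CC d) :
    chartLevi c (fun y ↦ f y - g y) x ξ = chartLevi c f x ξ - chartLevi c g x ξ :=
  leviForm_sub (contDiffAt_two_comp_symm hc hx hf) (contDiffAt_two_comp_symm hc hx hg) ξ

theorem continuousAt_bilin_apply {E F : Type*} [TopologicalSpace E] [NormedAddCommGroup F]
    [NormedSpace ℝ F] {H : E → F →L[ℝ] F →L[ℝ] ℝ} {z : E} (hH : ContinuousAt H z) (A : F →L[ℝ] F)
    (ξ : F) : ContinuousAt (fun q : E × F ↦ H q.1 (A q.2) (A q.2)) (z, ξ) := by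
  have h' : ContinuousAt (fun q : E × F ↦ H q.1) (z, ξ) :=
    ContinuousAt.comp (f := Prod.fst) hH continuousAt_fst
  have h2 : ContinuousAt (fun q : E × F ↦ A q.2) (z, ξ) := by fun_prop
  exact (h'.clm_apply h2).clm_apply h2

theorem continuousAt_leviForm {g : CC d → ℝ} {z : CC d} (hg : ContDiffAt ℝ ∞ g z) (ξ : CC d) :
    ContinuousAt (fun q : CC d × CC d ↦ leviForm g q.1 q.2) (z, ξ) := by
  have h : ContinuousAt (fderiv ℝ (fderiv ℝ g)) z :=
    ((hg.fderiv_right (m := ∞) (by simp)).fderiv_right (m := ∞) (by simp)).continuousAt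
  have h1 := continuousAt_bilin_apply h (ContinuousLinearMap.id ℝ (CC d)) ξ
  have h2 := continuousAt_bilin_apply h (Complex.I • ContinuousLinearMap.id ℝ (CC d)) ξ
  exact (h1.add h2).div_const 4

/-- The ratio of the two forms at `z` is bounded on the compact unit sphere; by continuity a strict
bound persists near `z`, uniformly on the sphere, and homogeneity of degree two gives all `ξ`. -/
theorem exists_abs_leviForm_le {f g : CC d → ℝ} {z : CC d} (hf : ContDiffAt ℝ ∞ f z)
    (hg : ContDiffAt ℝ ∞ g z) (hpos : ∀ ξ, ξ ≠ 0 → 0 < leviForm g z ξ) :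
    ∃ A, 0 ≤ A ∧ ∀ᶠ w in 𝓝 z, ∀ ξ, |leviForm f w ξ| ≤ A * leviForm g w ξ := by
  have hS : IsCompact (Metric.sphere (0 : CC d) 1) := isCompact_sphere 0 1
  have hne : ∀ ξ ∈ Metric.sphere (0 : CC d) 1, ξ ≠ 0 := fun ξ hξ ↦
    Metric.ne_of_mem_sphere hξ one_ne_zero
  have hline : ∀ ξ : CC d, ContinuousAt (fun ξ ↦ (z, ξ)) ξ := fun ξ ↦ by fun_prop
  have hcont : ContinuousOn (fun ξ ↦ |leviForm f z ξ| / leviForm g z ξ)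
      (Metric.sphere (0 : CC d) 1) := fun ξ hξ ↦ by
    have h1 : ContinuousAt (fun ξ ↦ leviForm f z ξ) ξ :=
      ContinuousAt.comp (f := fun ξ ↦ (z, ξ)) (continuousAt_leviForm hf ξ) (hline ξ)
    have h2 : ContinuousAt (fun ξ ↦ leviForm g z ξ) ξ :=
      ContinuousAt.comp (f := fun ξ ↦ (z, ξ)) (continuousAt_leviForm hg ξ) (hline ξ)
    exact (h1.abs.div h2 (hpos ξ (hne ξ hξ)).ne').continuousWithinAt
  obtain ⟨B, hB⟩ := hS.bddAbove_image hcont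
  -- The added `1` makes the inequality strict, hence an open condition.
  refine ⟨max B 0 + 1, by positivity, ?_⟩
  have hev : ∀ᶠ w in 𝓝 z, ∀ ξ ∈ Metric.sphere (0 : CC d) 1,
      |leviForm f w ξ| < (max B 0 + 1) * leviForm g w ξ := by
    refine hS.eventually_forall_of_forall_eventually fun ξ hξ ↦ ?_
    refine (continuousAt_leviForm hf ξ).abs.eventually_lt
      (continuousAt_const.mul (continuousAt_leviForm hg ξ)) ?_
    have hp := hpos ξ (hne ξ hξ)
    have h1 := hB (mem_image_of_mem _ hξ)
    simp only [div_le_iff₀ hp] at h1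
    have h2 : B ≤ max B 0 := le_max_left _ _
    simp only
    nlinarith
  filter_upwards [hev] with w hw ξ
  rcases eq_or_ne ξ 0 with rfl | hξ
  · have h0 : ∀ h : CC d → ℝ, leviForm h w 0 = 0 := fun h ↦ by simp [leviForm]
    simp [h0]
  · have h1 := hw ((‖ξ‖⁻¹ : ℝ) • ξ) (by simp [norm_smul, hξ])
    rw [leviForm_smul_vec, leviForm_smul_vec, abs_mul, abs_of_nonneg (by positivity)] at h1
    have h2 : 0 < (‖ξ‖⁻¹) ^ 2 := by have := norm_pos_iff.2 hξ; positivity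
    nlinarith

namespace IsKahlerPotential

variable {ι : Type*} {U : ι → Set X} {p : ι → X → ℝ}

/-- The Levi form of a smooth function on a compact manifold is bounded by the Kähler form. -/
theorem exists_abs_chartLevi_le [CompactSpace X] (hp : IsKahlerPotential (d := d) U p) {f : X → ℝ}
    (hf : ContMDiff 𝓘(ℝ, CC d) 𝓘(ℝ, ℝ) ∞ f) :
    ∃ A, 0 ≤ A ∧ ∀ i, ∀ x ∈ U i, ∀ c ∈ atlas (CC d) X, x ∈ c.source → ∀ ξ : CC d,
      |chartLevi c f x ξ| ≤ A * chartLevi c (p i) x ξ := by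
  suffices h : ∃ A, 0 ≤ A ∧ ∀ x ∈ (univ : Set X), ∀ i, x ∈ U i → ∀ c ∈ atlas (CC d) X,
      x ∈ c.source → ∀ ξ : CC d, |chartLevi c f x ξ| ≤ A * chartLevi c (p i) x ξ by
    obtain ⟨A, hA, h⟩ := h
    exact ⟨A, hA, fun i x hx ↦ h x (mem_univ x) i hx⟩
  refine isCompact_univ.induction_on (p := fun s ↦ ∃ A, 0 ≤ A ∧ ∀ x ∈ s, ∀ i, x ∈ U i →
      ∀ c ∈ atlas (CC d) X, x ∈ c.source → ∀ ξ : CC d,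
      |chartLevi c f x ξ| ≤ A * chartLevi c (p i) x ξ) ⟨0, le_rfl, by simp⟩ ?_ ?_ ?_
  · rintro s t hst ⟨A, hA, h⟩
    exact ⟨A, hA, fun x hx ↦ h x (hst hx)⟩
  · rintro s t ⟨A, hA, hs⟩ ⟨B, hB, ht⟩
    refine ⟨A + B, by positivity, fun x hx i hi c hc hxc ξ ↦ ?_⟩
    have hQ := hp.nonneg hi hc hxc ξ
    rcases hx with hx | hx
    · have := hs x hx i hi c hc hxc ξ
      nlinarith
    · have := ht x hx i hi c hc hxc ξ
      nlinarith
  · intro x _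
    obtain ⟨i, hi⟩ := hp.cover x
    set c := chartAt (CC d) x
    have hc : c ∈ atlas (CC d) X := chart_mem_atlas (CC d) x
    have hxc : x ∈ c.source := mem_chart_source (CC d) x
    obtain ⟨A, hA, hev⟩ := exists_abs_leviForm_le
      (contDiffAt_comp_symm_real hf.contMDiffAt hc hxc)
      (contDiffAt_comp_symm_real (hp.smooth i x hi) hc hxc) (hp.pos i x hi c hc hxc)
    have hev' := (c.continuousAt hxc).eventually hev
    refine ⟨_, mem_nhdsWithin_of_mem_nhds (inter_mem (inter_mem hev'
      ((hp.isOpen i).mem_nhds hi)) (c.open_source.mem_nhds hxc)), A, hA, ?_⟩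
    rintro y ⟨⟨hy, hyi⟩, hyc⟩ j hj c' hc' hyc' ξ
    -- The bound is known for one potential in one chart. A change of chart transforms `ξ` in the
    -- same way for both functions, so the bound holds in all charts.
    rw [hp.compat j i y hj hyi c' hc' hyc', chartLevi_change hc' hc hyc' hyc hf.contMDiffAt,
      chartLevi_change hc' hc hyc' hyc (hp.smooth i y hyi)]
    exact hy _

end IsKahlerPotential

end KahlerPotential

section Approximation

/-! ### Regularization of continuous `ω`-plurisubharmonic functions -/

variable {d : ℕ} {X : Type*} [TopologicalSpace X] [ChartedSpace (CC d) X]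
  [IsManifold 𝓘(ℂ, CC d) ω X]

namespace IsKahlerPotential

variable {ι : Type*} {U : ι → Set X} {p : ι → X → ℝ}

/-- The local regularization of `φ`, multiplied by a cut-off function `θ`. -/
theorem exists_local_weight [CompactSpace X] (hp : IsKahlerPotential (d := d) U p) {φ : X → ℝ}
    {i : ι} (hcont : ContinuousOn (fun x ↦ φ x + p i x) (U i))
    {c₀ : OpenPartialHomeomorph X (CC d)} (hc₀ : c₀ ∈ atlas (CC d) X)
    (hpsh : DdcNonnegOn (c₀.target ∩ c₀.symm ⁻¹' U i) (fun z ↦ φ (c₀.symm z) + p i (c₀.symm z)))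
    {θ : X → ℝ} (hθ : ContMDiff 𝓘(ℝ, CC d) 𝓘(ℝ, ℝ) ∞ θ) (h01 : ∀ x, θ x ∈ Icc (0 : ℝ) 1)
    (hsupp : tsupport θ ⊆ U i ∩ c₀.source) :
    ∃ D, 0 ≤ D ∧ ∀ m : ℝ, 0 < m → ∃ a : X → ℝ, ContMDiff 𝓘(ℝ, CC d) 𝓘(ℝ, ℝ) ∞ a ∧
      (∀ x, a x ^ 2 ≤ Real.exp (m * φ x + 1)) ∧
      (∀ x, θ x = 1 → Real.exp (m * φ x - 1) ≤ a x ^ 2) ∧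
      ∀ j, ∀ x ∈ U j, ∀ c ∈ atlas (CC d) X, x ∈ c.source → ∀ ξ : CC d,
        -((a x ^ 2 * m + D * Real.exp (m * φ x + 1)) * chartLevi c (p j) x ξ) ≤
          4 * a x * chartLevi c a x ξ - chartLevi c (fun y ↦ a y ^ 2) x ξ := by
  obtain ⟨A₁, hA₁, h₁⟩ := hp.exists_abs_chartLevi_le hθ
  obtain ⟨A₂, hA₂, h₂⟩ := hp.exists_abs_chartLevi_le (hθ.pow 2)
  -- `D` comes from the Levi forms of `θ` and `θ²` only, and is thus fixed before `m`.
  refine ⟨4 * A₁ + A₂, by positivity, fun m hm ↦ ?_⟩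
  have hW : IsOpen (c₀.target ∩ c₀.symm ⁻¹' U i) := c₀.symm.isOpen_inter_preimage (hp.isOpen i)
  have hK : IsCompact (c₀ '' tsupport θ) :=
    (isClosed_tsupport θ).isCompact.image_of_continuousOn
      (c₀.continuousOn.mono fun x hx ↦ (hsupp hx).2)
  have hKW : c₀ '' tsupport θ ⊆ c₀.target ∩ c₀.symm ⁻¹' U i := by
    rintro _ ⟨x, hx, rfl⟩
    refine ⟨c₀.map_source (hsupp hx).2, ?_⟩
    rw [mem_preimage, c₀.left_inv (hsupp hx).2]
    exact (hsupp hx).1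
  have hu : ContinuousOn (fun z ↦ φ (c₀.symm z) + p i (c₀.symm z))
      (c₀.target ∩ c₀.symm ⁻¹' U i) :=
    ContinuousOn.comp (f := c₀.symm) hcont (c₀.symm.continuousOn.mono inter_subset_left)
      fun z hz ↦ hz.2
  -- Precision `1/m` becomes an error of at most `1` in the exponent `g`, whence the `± 1` in the
  -- bounds.
  obtain ⟨v, hv, hvu, hvl⟩ := hpsh.exists_smooth_approx hW hK hKW hu (inv_pos.2 hm)
  set g : X → ℝ := fun x ↦ m * (v (c₀ x) - p i x) with hg
  have hgs : ∀ x ∈ tsupport θ, ContMDiffAt 𝓘(ℝ, CC d) 𝓘(ℝ, ℝ) ∞ g x := fun x hx ↦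
    contMDiffAt_const.mul ((contMDiffAt_comp_chart_real hc₀ (hsupp hx).2 hv.contDiffAt).sub
      (hp.smooth i x (hsupp hx).1))
  have hgφ : ∀ x ∈ tsupport θ, |g x - m * φ x| ≤ 1 := fun x hx ↦ by
    have h := hvu (c₀ x) (mem_image_of_mem _ hx)
    rw [c₀.left_inv (hsupp hx).2] at h
    have e : g x - m * φ x = m * (v (c₀ x) - (φ x + p i x)) := by simp only [hg]; ring
    rw [e, abs_mul, abs_of_pos hm]
    calc m * _ ≤ m * m⁻¹ := by gcongr
      _ = 1 := mul_inv_cancel₀ hm.ne'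
  have hexp : ∀ x, (Real.exp (g x / 2)) ^ 2 = Real.exp (g x) := fun x ↦ by
    rw [← Real.exp_nat_mul]; congr 1; push_cast; ring
  set a : X → ℝ := fun x ↦ θ x * Real.exp (g x / 2) with ha
  have ha2 : ∀ x, a x ^ 2 = θ x ^ 2 * Real.exp (g x) := fun x ↦ by
    rw [← hexp]; simp only [ha]; ring
  have hzero : ∀ x, x ∉ tsupport θ → a =ᶠ[𝓝 x] fun _ ↦ 0 := fun x hx ↦ by
    filter_upwards [notMem_tsupport_iff_eventuallyEq.1 hx] with y hy
    simp [ha, hy]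
  refine ⟨a, fun x ↦ ?_, fun x ↦ ?_, fun x hx ↦ ?_, fun j x hj c hc hxc ξ ↦ ?_⟩
  · by_cases hx : x ∈ tsupport θ
    · have he : ContMDiffAt 𝓘(ℝ, ℝ) 𝓘(ℝ, ℝ) ∞ (fun t : ℝ ↦ Real.exp (t / 2)) (g x) :=
        contMDiffAt_iff_contDiffAt.2 (by fun_prop)
      have he' : ContMDiffAt 𝓘(ℝ, CC d) 𝓘(ℝ, ℝ) ∞ (fun y ↦ Real.exp (g y / 2)) x :=
        ContMDiffAt.comp (g := fun t : ℝ ↦ Real.exp (t / 2)) (f := g) x he (hgs x hx)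
      exact hθ.contMDiffAt.mul he'
    · exact contMDiffAt_const.congr_of_eventuallyEq (hzero x hx)
  · by_cases hx : x ∈ tsupport θ
    · rw [ha2]
      have h := (abs_le.1 (hgφ x hx)).2
      calc θ x ^ 2 * Real.exp (g x) ≤ 1 * Real.exp (m * φ x + 1) := by
            gcongr
            · exact pow_le_one₀ (h01 x).1 (h01 x).2
            · linarith
        _ = _ := one_mul _
    · rw [(hzero x hx).eq_of_nhds]
      simpa using (Real.exp_pos _).le
  · have hxs : x ∈ tsupport θ := subset_tsupport θ (by simp [hx])
    rw [ha2, hx, one_pow, one_mul, Real.exp_le_exp]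
    linarith [(abs_le.1 (hgφ x hxs)).1]
  · have hQ := hp.nonneg hj hc hxc ξ
    set Q := chartLevi c (p j) x ξ with hQdef
    by_cases hx : x ∈ tsupport θ
    · have hxx : c.symm (c x) = x := c.left_inv hxc
      have key := leviForm_mul_exp (contDiffAt_two_comp_symm hc hxc hθ.contMDiffAt)
        (contDiffAt_two_comp_symm hc hxc (hgs x hx)) ξ
      simp only [hxx] at key
      have hvx := contMDiffAt_comp_chart_real hc₀ (hsupp hx).2 (hv.contDiffAt (x := c₀ x))
      -- In `g = m (v - p)`, `v` contributes a non-negative term and `p` contributes `-m Q`.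
      have hL : -(m * Q) ≤ chartLevi c g x ξ := by
        have e1 : chartLevi c g x ξ = m * (chartLevi c (fun y ↦ v (c₀ y)) x ξ - Q) := by
          rw [hQdef, hp.compat j i x hj (hsupp hx).1 c hc hxc, ← chartLevi_sub hc hxc hvx
            (hp.smooth i x (hsupp hx).1)]
          exact chartLevi_const_mul hc hxc (hvx.sub (hp.smooth i x (hsupp hx).1)) m ξ
        have e2 : 0 ≤ chartLevi c (fun y ↦ v (c₀ y)) x ξ := by
          rw [chartLevi_change hc hc₀ hxc (hsupp hx).2 hvx]
          have e3 : ∀ η, chartLevi c₀ (fun y ↦ v (c₀ y)) x η = leviForm v (c₀ x) η := fun η ↦ by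
            refine leviForm_congr ?_ η
            filter_upwards [c₀.open_target.mem_nhds (c₀.map_source (hsupp hx).2)] with z hz
            rw [c₀.right_inv hz]
          rw [e3]
          exact hvl _ (mem_image_of_mem _ hx) _
        rw [e1]
        nlinarith
      have hθ1 := abs_le.1 (h₁ j x hj c hc hxc ξ)
      have hθ2 := abs_le.1 (h₂ j x hj c hc hxc ξ)
      rw [← hQdef] at hθ1 hθ2
      have h0 := (h01 x).1
      have h1 := (h01 x).2
      change _ ≤ 4 * (θ x * Real.exp (g x / 2)) *
        leviForm (fun z ↦ θ (c.symm z) * Real.exp (g (c.symm z) / 2)) (c x) ξ -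
        leviForm (fun z ↦ (θ (c.symm z) * Real.exp (g (c.symm z) / 2)) ^ 2) (c x) ξ
      rw [key, ha2]
      change _ ≤ Real.exp (g x) * (4 * θ x * chartLevi c θ x ξ -
        chartLevi c (fun y ↦ θ y ^ 2) x ξ + θ x ^ 2 * chartLevi c g x ξ)
      have b1 : -(A₁ * Q) ≤ θ x * chartLevi c θ x ξ := by
        nlinarith [mul_nonneg hA₁ hQ, mul_le_mul_of_nonneg_left hθ1.1 h0]
      have b2 : chartLevi c (fun y ↦ θ y ^ 2) x ξ ≤ A₂ * Q := hθ2.2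
      have b3 : -(θ x ^ 2 * (m * Q)) ≤ θ x ^ 2 * chartLevi c g x ξ := by
        nlinarith [mul_le_mul_of_nonneg_left hL (sq_nonneg (θ x))]
      have b4 : Real.exp (g x) ≤ Real.exp (m * φ x + 1) :=
        Real.exp_le_exp.2 (by linarith [(abs_le.1 (hgφ x hx)).2])
      have b5 : 0 ≤ (4 * A₁ + A₂) * Q := by positivity
      have b6 := mul_le_mul_of_nonneg_right b4 b5
      have b7 : -((4 * A₁ + A₂) * Q) - θ x ^ 2 * (m * Q) ≤ 4 * θ x * chartLevi c θ x ξ -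
          chartLevi c (fun y ↦ θ y ^ 2) x ξ + θ x ^ 2 * chartLevi c g x ξ := by linarith
      have b8 := mul_le_mul_of_nonneg_left b7 (Real.exp_pos (g x)).le
      linarith
    · have e0 : ∀ η, chartLevi c (fun y ↦ a y ^ 2) x η = 0 := fun η ↦ by
        rw [chartLevi_congr (g := fun _ ↦ 0) hxc ((hzero x hx).mono fun y hy ↦ by simp [hy])]
        simp [chartLevi, leviForm]
      rw [e0, (hzero x hx).eq_of_nhds]
      have : 0 ≤ (4 * A₁ + A₂) * Real.exp (m * φ x + 1) * Q := by positivity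
      simp only [mul_zero, zero_mul, sub_zero]
      linarith

/-- Every continuous function `φ` such that `ω + dd^c φ` is a positive current is a uniform limit
of smooth functions with the same property. -/
theorem exists_smooth_approx [T2Space X] [CompactSpace X] (hp : IsKahlerPotential (d := d) U p)
    {φ : X → ℝ} (hcont : ∀ i, ContinuousOn (fun x ↦ φ x + p i x) (U i))
    (hpsh : ∀ i, ∀ c ∈ atlas (CC d) X, DdcNonnegOn (c.target ∩ c.symm ⁻¹' U i)
      (fun z ↦ φ (c.symm z) + p i (c.symm z))) {ε : ℝ} (hε : 0 < ε) :
    ∃ ψ : X → ℝ, ContMDiff 𝓘(ℝ, CC d) 𝓘(ℝ, ℝ) ∞ ψ ∧ (∀ x, |ψ x - φ x| ≤ ε) ∧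
      ∀ i, ∀ x ∈ U i, ∀ c ∈ atlas (CC d) X, x ∈ c.source → ∀ ξ : CC d,
        0 ≤ chartLevi c ψ x ξ + chartLevi c (p i) x ξ := by
  have := isManifold_real (d := d) (X := X)
  have hφ : Continuous φ := by
    rw [continuous_iff_continuousAt]
    intro x
    obtain ⟨i, hi⟩ := hp.cover x
    have h := ((hcont i).continuousAt ((hp.isOpen i).mem_nhds hi)).sub
      (hp.smooth i x hi).continuousAt
    exact h.congr (.of_forall fun y ↦ by simp)
  obtain ⟨B, hB⟩ := isCompact_univ.exists_bound_of_continuousOn hφ.continuousOn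
  have hB' : ∀ x, |φ x| ≤ max B 0 := fun x ↦ (hB x (mem_univ x)).trans (le_max_left _ _)
  choose i hi using hp.cover
  have hbump : ∀ x, ∃ f : SmoothBumpFunction 𝓘(ℝ, CC d) x, tsupport f ⊆ U (i x) := fun x ↦ by
    obtain ⟨f, -, hf⟩ := (SmoothBumpFunction.nhds_basis_tsupport (I := 𝓘(ℝ, CC d)) x).mem_iff.1
      ((hp.isOpen _).mem_nhds (hi x))
    exact ⟨f, hf⟩
  choose θ hθ using hbump
  obtain ⟨t, ht⟩ := CompactSpace.elim_nhds_subcover (fun x ↦ {y | θ x y = 1})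
    fun x ↦ (θ x).eventuallyEq_one
  have hloc := fun x ↦ hp.exists_local_weight (hcont (i x)) (chart_mem_atlas (CC d) x)
    (hpsh (i x) _ (chart_mem_atlas (CC d) x)) (θ x).contMDiff (fun y ↦ (θ x).mem_Icc)
    fun y hy ↦ ⟨hθ x hy, (θ x).tsupport_subset_chartAt_source hy⟩
  choose D hD hloc using hloc
  -- The factor `exp 2` compares the error weight `exp(mφ + 1)` with the lower bound `exp(mφ - 1) ≤
  -- S`.
  set C : ℝ := Real.exp 2 * ∑ x ∈ t, D x with hC
  have hC0 : 0 ≤ C := mul_nonneg (Real.exp_pos _).le (Finset.sum_nonneg fun x _ ↦ hD x)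
  -- `M` bounds `|log S - (m + C) φ|` for every `m`: the first terms come from `exp(mφ - 1) ≤ S ≤
  -- card t · exp(mφ + 1)`, the last one from replacing `m` by `m + C`.
  set M : ℝ := 1 + t.card + C * max B 0 with hM
  have hM0 : 0 < M := by positivity
  set m : ℝ := M / ε with hm
  have hm0 : 0 < m := by positivity
  have hloc' := fun x ↦ hloc x m hm0
  choose a has hale hage hal using hloc'
  set S : X → ℝ := fun y ↦ ∑ x ∈ t, a x y ^ 2 with hS
  have hSge : ∀ y, Real.exp (m * φ y - 1) ≤ S y := fun y ↦ by
    have hy : y ∈ ⋃ x ∈ t, {y | θ x y = 1} := by rw [ht]; trivial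
    simp only [mem_iUnion, mem_ofPred_eq, exists_prop] at hy
    obtain ⟨x, hx, hxy⟩ := hy
    exact (hage x y hxy).trans
      (Finset.single_le_sum (f := fun x ↦ a x y ^ 2) (fun x _ ↦ sq_nonneg _) hx)
  have hSle : ∀ y, S y ≤ t.card * Real.exp (m * φ y + 1) := fun y ↦ by
    simpa using Finset.sum_le_card_nsmul t (fun x ↦ a x y ^ 2) _ fun x _ ↦ hale x y
  have hS0 : ∀ y, 0 < S y := fun y ↦ (Real.exp_pos _).trans_le (hSge y)
  have hSs : ContMDiff 𝓘(ℝ, CC d) 𝓘(ℝ, ℝ) ∞ S :=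
    contMDiff_finsetSum fun x _ ↦ (has x).pow 2
  have hlogS : ContMDiff 𝓘(ℝ, CC d) 𝓘(ℝ, ℝ) ∞ (fun y ↦ Real.log (S y)) := fun y ↦
    ContMDiffAt.comp y (contMDiffAt_iff_contDiffAt.2 (Real.contDiffAt_log.2 (hS0 y).ne'))
      hSs.contMDiffAt
  have hmC : 0 < m + C := by positivity
  -- Dividing by `m + C` instead of `m` absorbs the gluing error, so that the Levi form of `ψ` is at
  -- least `-Q` exactly.
  refine ⟨fun y ↦ (m + C)⁻¹ * Real.log (S y), contMDiff_const.mul hlogS, fun y ↦ ?_,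
    fun j y hj c hc hyc ξ ↦ ?_⟩
  · have h1 : m * φ y - 1 ≤ Real.log (S y) := (Real.le_log_iff_exp_le (hS0 y)).2 (hSge y)
    have hcard : (0 : ℝ) < t.card := by
      rcases (Nat.cast_nonneg (α := ℝ) t.card).eq_or_lt with h | h
      · have := (hS0 y).trans_le (hSle y)
        rw [← h, zero_mul] at this
        exact absurd this (lt_irrefl _)
      · exact h
    have h2 : Real.log (S y) ≤ t.card + (m * φ y + 1) := by
      refine (Real.log_le_log (hS0 y) (hSle y)).trans ?_
      rw [Real.log_mul hcard.ne' (Real.exp_pos _).ne', Real.log_exp]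
      have := Real.log_le_sub_one_of_pos hcard
      linarith
    have h3 := abs_le.1 (hB' y)
    have h4 : |Real.log (S y) - (m + C) * φ y| ≤ M := by
      rw [abs_le]
      constructor <;> nlinarith
    have e : (m + C)⁻¹ * Real.log (S y) - φ y =
        (m + C)⁻¹ * (Real.log (S y) - (m + C) * φ y) := by field_simp
    rw [e, abs_mul, abs_of_pos (inv_pos.2 hmC), inv_mul_le_iff₀ hmC]
    refine h4.trans ?_
    have : M = m * ε := by rw [hm]; field_simp
    nlinarith
  · have hQ := hp.nonneg hj hc hyc ξ
    set Q := chartLevi c (p j) y ξ with hQdef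
    rw [chartLevi_const_mul hc hyc hlogS.contMDiffAt]
    have hyy : c.symm (c y) = y := c.left_inv hyc
    have key := leviForm_log_sum_sq_ge t (a := fun x z ↦ a x (c.symm z)) (z := c y)
      (fun x _ ↦ contDiffAt_two_comp_symm hc hyc (has x).contMDiffAt)
      (by simpa only [hyy] using hS0 y) ξ
    simp only [hyy] at key
    change (∑ x ∈ t, (4 * a x y * chartLevi c (a x) y ξ - chartLevi c (fun w ↦ a x w ^ 2) y ξ)) /
      S y ≤ chartLevi c (fun w ↦ Real.log (S w)) y ξ at key
    have hsum : -((S y * m + (∑ x ∈ t, D x) * Real.exp (m * φ y + 1)) * Q) ≤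
        ∑ x ∈ t, (4 * a x y * chartLevi c (a x) y ξ - chartLevi c (fun w ↦ a x w ^ 2) y ξ) := by
      refine le_trans (le_of_eq ?_) (Finset.sum_le_sum fun x _ ↦ hal x j y hj c hc hyc ξ)
      rw [Finset.sum_neg_distrib, ← Finset.sum_mul, Finset.sum_add_distrib, ← Finset.sum_mul,
        ← Finset.sum_mul]
    have hexp : (∑ x ∈ t, D x) * Real.exp (m * φ y + 1) ≤ S y * C := by
      have e : Real.exp (m * φ y + 1) = Real.exp 2 * Real.exp (m * φ y - 1) := by
        rw [← Real.exp_add]; congr 1; ring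
      have hD0 : 0 ≤ ∑ x ∈ t, D x := Finset.sum_nonneg fun x _ ↦ hD x
      rw [e, hC]
      calc (∑ x ∈ t, D x) * (Real.exp 2 * Real.exp (m * φ y - 1))
          ≤ (∑ x ∈ t, D x) * (Real.exp 2 * S y) := by gcongr; exact hSge y
        _ = _ := by ring
    have hfin : -((m + C) * Q) ≤ chartLevi c (fun w ↦ Real.log (S w)) y ξ := by
      refine le_trans ?_ key
      rw [le_div_iff₀ (hS0 y)]
      refine le_trans ?_ hsum
      nlinarith [mul_le_mul_of_nonneg_right hexp hQ]
    have h1 := mul_le_mul_of_nonneg_left hfin (inv_pos.2 hmC).le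
    have e : (m + C)⁻¹ * -((m + C) * Q) = -Q := by field_simp
    linarith

end IsKahlerPotential

end Approximation

/-! ### The Fubini–Study potentials of an ample line bundle -/

section Potential

variable {d : ℕ} {X : Type*} [TopologicalSpace X] [ChartedSpace (CC d) X]
  {L : X → Type*} [∀ x, AddCommGroup (L x)] [∀ x, Module ℂ (L x)]

/-- The components of finitely many sections of `L^{⊗k}` in the frame `s`. -/
structure IsComponents (k : ℕ) {N : ℕ} (σ : Fin (N + 1) → ∀ x, ⨂[ℂ]^k (L x)) (U : Set X)
    (s : ∀ x, L x) (F : X → EuclideanSpace ℂ (Fin (N + 1))) : Prop where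
  holomorphic : ContMDiffOn 𝓘(ℂ, CC d) 𝓘(ℂ, EuclideanSpace ℂ (Fin (N + 1))) ω F U
  eq_smul : ∀ x ∈ U, ∀ i, σ i x = F x i • PiTensorProduct.tprod ℂ (fun _ : Fin k ↦ s x)

namespace IsComponents

variable {k N : ℕ} {σ : Fin (N + 1) → ∀ x, ⨂[ℂ]^k (L x)} {U U' : Set X} {s s' : ∀ x, L x}
  {F F' : X → EuclideanSpace ℂ (Fin (N + 1))}

theorem contMDiffAt (hF : IsComponents (d := d) k σ U s F) (hU : IsOpen U) {x : X} (hx : x ∈ U) :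
    ContMDiffAt 𝓘(ℂ, CC d) 𝓘(ℂ, EuclideanSpace ℂ (Fin (N + 1))) ω F x :=
  hF.holomorphic.contMDiffAt (hU.mem_nhds hx)

theorem tprod_ne_zero (hF : IsComponents (d := d) k σ U s F) {x : X} (hx : x ∈ U) {i}
    (hi : σ i x ≠ 0) : PiTensorProduct.tprod ℂ (fun _ : Fin k ↦ s x) ≠ 0 := fun h ↦
  hi (by rw [hF.eq_smul x hx, h, smul_zero])

theorem apply_ne_zero_iff (hF : IsComponents (d := d) k σ U s F) {x : X} (hx : x ∈ U)
    {i₀} (hi₀ : σ i₀ x ≠ 0) (i) : F x i ≠ 0 ↔ σ i x ≠ 0 := by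
  rw [hF.eq_smul x hx, smul_ne_zero_iff, and_iff_left (hF.tprod_ne_zero hx hi₀)]

theorem mul_apply_eq (hF : IsComponents (d := d) k σ U s F)
    (hF' : IsComponents (d := d) k σ U' s' F') {x : X} (hx : x ∈ U) (hx' : x ∈ U') {j}
    (hj : σ j x ≠ 0) (i) : F x j * F' x i = F' x j * F x i := by
  have ht' := hF'.tprod_ne_zero hx' hj
  have e1 := (hF.eq_smul x hx i).symm.trans (hF'.eq_smul x hx' i)
  have e2 := (hF.eq_smul x hx j).symm.trans (hF'.eq_smul x hx' j)
  have e3 : (F x j * F' x i) • PiTensorProduct.tprod ℂ (fun _ : Fin k ↦ s' x) =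
      (F' x j * F x i) • PiTensorProduct.tprod ℂ (fun _ : Fin k ↦ s' x) := by
    rw [mul_smul, ← e1, smul_comm, e2, smul_smul, mul_comm]
  exact smul_left_injective ℂ ht' e3

variable [IsManifold 𝓘(ℂ, CC d) ω X]

/-- Two frames give the same Levi form of the Fubini–Study potential. -/
theorem chartLevi_log_norm_sq_eq (hF : IsComponents (d := d) k σ U s F)
    (hF' : IsComponents (d := d) k σ U' s' F') (hU : IsOpen U) (hU' : IsOpen U')
    (hσ : ∀ x, ∃ i, σ i x ≠ 0) {x : X} (hx : x ∈ U) (hx' : x ∈ U')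
    {c : OpenPartialHomeomorph X (CC d)}
    (hc : c ∈ atlas (CC d) X) (hxc : x ∈ c.source) (ξ : CC d) :
    chartLevi c (fun y ↦ Real.log (‖F y‖ ^ 2)) x ξ =
      chartLevi c (fun y ↦ Real.log (‖F' y‖ ^ 2)) x ξ := by
  obtain ⟨j, hj⟩ := hσ x
  have hFj := (hF.apply_ne_zero_iff hx hj j).2 hj
  have hF'j := (hF'.apply_ne_zero_iff hx' hj j).2 hj
  have hxx : c.symm (c x) = x := c.left_inv hxc
  have hFc := contDiffAt_comp_symm_complex (hF.contMDiffAt hU hx) hc hxc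
  have hF'c := contDiffAt_comp_symm_complex (hF'.contMDiffAt hU' hx') hc hxc
  have hFcj := (contDiffAt_piLp 2).1 hFc j
  have hF'cj := (contDiffAt_piLp 2).1 hF'c j
  -- Near `x`, `F = G F'` with `G = F_j / F'_j` holomorphic and without zeros, so the two potentials
  -- differ by the pluriharmonic function `log |G|²`.
  have hG : ContDiffAt ℂ ω (fun z ↦ F (c.symm z) j / F' (c.symm z) j) (c x) :=
    hFcj.div hF'cj (by simpa only [hxx] using hF'j)
  have hG0 : F (c.symm (c x)) j / F' (c.symm (c x)) j ≠ 0 := by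
    rw [hxx]; exact div_ne_zero hFj hF'j
  have hF'0 : F' (c.symm (c x)) ≠ 0 := fun h0 ↦ hF'j (by rw [hxx] at h0; simp [h0])
  have hev : (fun z ↦ Real.log (‖F (c.symm z)‖ ^ 2)) =ᶠ[𝓝 (c x)] fun z ↦
      Real.log (‖F (c.symm z) j / F' (c.symm z) j‖ ^ 2) + Real.log (‖F' (c.symm z)‖ ^ 2) := by
    have hcs : ContinuousAt c.symm (c x) := c.symm.continuousAt (c.map_source hxc)
    filter_upwards [hcs.preimage_mem_nhds (hU.mem_nhds (by rwa [hxx])),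
      hcs.preimage_mem_nhds (hU'.mem_nhds (by rwa [hxx])), hG.continuousAt.eventually_ne hG0,
      hF'c.continuousAt.eventually_ne hF'0] with z hz hz' hzG hzF'
    have hz1 : F (c.symm z) j ≠ 0 := fun h ↦ hzG (by rw [h, zero_div])
    have hz2 : F' (c.symm z) j ≠ 0 := fun h ↦ hzG (by rw [h, div_zero])
    obtain ⟨j', hj'⟩ := hσ (c.symm z)
    have hσz : σ j (c.symm z) ≠ 0 := (hF.apply_ne_zero_iff hz hj' j).1 hz1
    have e : F (c.symm z) = (F (c.symm z) j / F' (c.symm z) j) • F' (c.symm z) := by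
      ext i
      have := hF.mul_apply_eq hF' hz hz' hσz i
      simp only [PiLp.smul_apply, smul_eq_mul]
      field_simp
      linear_combination -this
    rw [← Real.log_mul (by simpa using hzG) (by simpa using hzF'), ← mul_pow, ← norm_smul, ← e]
  rw [chartLevi, leviForm_congr hev, leviForm_add
    ((((hG.of_le le_top).restrict_scalars ℝ).norm_sq ℝ).log (by simpa using hG0))
    ((((hF'c.of_le le_top).restrict_scalars ℝ).norm_sq ℝ).log (by simpa using hF'0)),
    leviForm_log_norm_sq_eq_zero (hG.of_le le_top) hG0, zero_add, chartLevi]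

/-- The Levi form is the Cauchy–Schwarz defect between `F` and its derivative along `ξ`. If it
vanished, this derivative would be a multiple of `F`, and all quotients `F_j / F_i` would be
stationary along `ξ`, against the immersion hypothesis. -/
theorem leviForm_log_norm_sq_pos (hF : IsComponents (d := d) k σ U s F) (hU : IsOpen U)
    {φ : X → ℙ ℂ (Fin (N + 1) → ℂ)}
    (hφ : ∀ x, ∃ e : ⨂[ℂ]^k (L x), e ≠ 0 ∧ ∀ i, σ i x = (φ x).rep i • e)
    (himm : ∀ (x : X) (v : TangentSpace 𝓘(ℂ, CC d) x), v ≠ 0 →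
      ∃ i j, (φ x).rep i ≠ 0 ∧
        mfderiv 𝓘(ℂ, CC d) 𝓘(ℂ, ℂ) (fun y ↦ (φ y).rep j / (φ y).rep i) x v ≠ 0)
    {c : OpenPartialHomeomorph X (CC d)} (hc : c ∈ atlas (CC d) X) {z : CC d} (hz : z ∈ c.target)
    (hzU : c.symm z ∈ U) {ξ : CC d} (hξ : ξ ≠ 0) :
    0 < leviForm (fun w ↦ Real.log (‖F (c.symm w)‖ ^ 2)) z ξ := by
  -- `rep` is an arbitrary representative with no regularity in `y`; only its quotients are used,
  -- and they are those of the holomorphic vector `F`.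
  have hquot : ∀ y ∈ U, ∀ i, (φ y).rep i ≠ 0 → F y i ≠ 0 ∧
      ∀ j, (φ y).rep j / (φ y).rep i = F y j / F y i := by
    intro y hy i hi
    obtain ⟨e, he, hσ⟩ := hφ y
    have hσi : σ i y ≠ 0 := by rw [hσ]; exact smul_ne_zero hi he
    have hFi := (hF.apply_ne_zero_iff hy hσi i).2 hσi
    refine ⟨hFi, fun j ↦ ?_⟩
    have e1 := (hσ i).symm.trans (hF.eq_smul y hy i)
    have e2 := (hσ j).symm.trans (hF.eq_smul y hy j)
    have e3 : ((φ y).rep j * F y i) • PiTensorProduct.tprod ℂ (fun _ : Fin k ↦ s y) =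
        (F y j * (φ y).rep i) • PiTensorProduct.tprod ℂ (fun _ : Fin k ↦ s y) := by
      rw [mul_smul, ← e1, smul_comm, e2, smul_smul, mul_comm]
    rw [div_eq_div_iff hi hFi]
    exact smul_left_injective ℂ (hF.tprod_ne_zero hy hσi) e3
  have hquot' : ∀ y ∈ U, ∀ i, F y i ≠ 0 → (φ y).rep i ≠ 0 := by
    intro y hy i hi hi'
    obtain ⟨e, he, hσ⟩ := hφ y
    obtain ⟨i₀, hi₀⟩ : ∃ i₀, (φ y).rep i₀ ≠ 0 := Function.ne_iff.1 (φ y).rep_nonzero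
    have hσi : σ i₀ y ≠ 0 := by rw [hσ]; exact smul_ne_zero hi₀ he
    exact (hF.apply_ne_zero_iff hy hσi i).1 hi (by rw [hσ, hi', zero_smul])
  have hcm := mdifferentiable_of_mem_atlas (I := 𝓘(ℂ, CC d)) hc
  set v : TangentSpace 𝓘(ℂ, CC d) (c.symm z) := mfderiv 𝓘(ℂ, CC d) 𝓘(ℂ, CC d) c.symm z ξ
  have hv0 : v ≠ 0 := fun h0 ↦ hξ <| by
    have h : mfderiv 𝓘(ℂ, CC d) 𝓘(ℂ, CC d) c (c.symm z) v = ξ :=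
      DFunLike.congr_fun (hcm.comp_symm_deriv hz) ξ
    rw [h0, map_zero] at h
    exact h.symm
  obtain ⟨i, j, hi, hij⟩ := himm _ v hv0
  have hFi := (hquot _ hzU i hi).1
  have hxc : c.symm z ∈ c.source := c.map_target hz
  have hFx := hF.contMDiffAt hU hzU
  have hFc := contDiffAt_comp_symm_complex hFx hc hxc
  rw [c.right_inv hz] at hFc
  have hFz : F (c.symm z) ≠ 0 := fun h ↦ hFi (by simp [h])
  rw [leviForm_log_norm_sq (hFc.of_le le_top) hFz]
  set a := fderiv ℂ (fun w ↦ F (c.symm w)) z ξ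
  refine div_pos (sub_pos.2 ?_) (by positivity)
  rw [← mul_pow]
  refine pow_lt_pow_left₀ (lt_of_le_of_ne (norm_inner_le_norm _ _) fun heq ↦ hij ?_)
    (norm_nonneg _) two_ne_zero
  obtain ⟨r, hr⟩ : ∃ r : ℂ, a = r • F (c.symm z) := by
    rcases eq_or_ne a 0 with h | h
    · exact ⟨0, by rw [h, zero_smul]⟩
    · obtain ⟨r, -, hr⟩ := (norm_inner_eq_norm_iff hFz h).1 heq
      exact ⟨r, hr⟩
  have hev : (fun y ↦ (φ y).rep j / (φ y).rep i) =ᶠ[𝓝 (c.symm z)] fun y ↦ F y j / F y i := by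
    have hFi' : ContinuousAt (fun y ↦ F y i) (c.symm z) :=
      (EuclideanSpace.proj (𝕜 := ℂ) i).continuous.continuousAt.comp hFx.continuousAt
    filter_upwards [hU.mem_nhds hzU, hFi'.eventually_ne hFi] with y hy hyi
    exact (hquot y hy i (hquot' y hy i hyi)).2 j
  rw [hev.mfderiv_eq]
  have hdcoord : ∀ l, HasFDerivAt (fun w ↦ F (c.symm w) l)
      ((EuclideanSpace.proj (𝕜 := ℂ) l).comp (fderiv ℂ (fun w ↦ F (c.symm w)) z)) z := fun l ↦
    (EuclideanSpace.proj (𝕜 := ℂ) l).hasFDerivAt.comp z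
      (hFc.differentiableAt (by simp)).hasFDerivAt
  have hcoord : ∀ l, ContMDiffAt 𝓘(ℂ, CC d) 𝓘(ℂ, ℂ) ω (fun y ↦ F y l) (c.symm z) := fun l ↦
    ContMDiffAt.comp (I' := 𝓘(ℂ, EuclideanSpace ℂ (Fin (N + 1)))) _
      (EuclideanSpace.proj (𝕜 := ℂ) l).contDiff.contMDiff.contMDiffAt hFx
  have hq : MDifferentiableAt 𝓘(ℂ, CC d) 𝓘(ℂ, ℂ) (fun y ↦ F y j / F y i) (c.symm z) :=
    ((hcoord j).div₀ (hcoord i) hFi).mdifferentiableAt (by simp)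
  have hchain := mfderiv_comp z hq (hcm.mdifferentiableAt_symm hz)
  rw [mfderiv_eq_fderiv] at hchain
  have h1 : mfderiv 𝓘(ℂ, CC d) 𝓘(ℂ, ℂ) (fun y ↦ F y j / F y i) (c.symm z) v =
      fderiv ℂ (fun w ↦ F (c.symm w) j / F (c.symm w) i) z ξ :=
    (DFunLike.congr_fun hchain ξ).symm
  refine h1.trans ?_
  have hqd : DifferentiableAt ℂ (fun w ↦ F (c.symm w) j / F (c.symm w) i) z :=
    (((contDiffAt_piLp 2).1 hFc j).div ((contDiffAt_piLp 2).1 hFc i) hFi).differentiableAt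
      (by simp)
  -- Differentiate `F_j = (F_j / F_i) F_i`: since `a = r • F`, the terms `r F_j` cancel and leave
  -- `F_i` times the derivative of the quotient.
  have hprod := hqd.hasFDerivAt.mul (hdcoord i)
  have hev2 : (fun w ↦ F (c.symm w) j) =ᶠ[𝓝 z]
      (fun w ↦ F (c.symm w) j / F (c.symm w) i) * fun w ↦ F (c.symm w) i := by
    filter_upwards [(hdcoord i).continuousAt.eventually_ne hFi] with w hw
    simp [hw]
  have h2 : a j = F (c.symm z) j / F (c.symm z) i * a i +
      F (c.symm z) i * fderiv ℂ (fun w ↦ F (c.symm w) j / F (c.symm w) i) z ξ :=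
    DFunLike.congr_fun ((hdcoord j).unique (hprod.congr_of_eventuallyEq hev2)) ξ
  have h3 : F (c.symm z) i * fderiv ℂ (fun w ↦ F (c.symm w) j / F (c.symm w) i) z ξ = 0 := by
    have h4 : F (c.symm z) j / F (c.symm z) i * (r * F (c.symm z) i) = r * F (c.symm z) j := by
      field_simp
    simp only [hr, PiLp.smul_apply, smul_eq_mul, h4] at h2
    linear_combination -h2
  exact (mul_eq_zero.1 h3).resolve_left hFi

end IsComponents

variable [TopologicalSpace (TotalSpace ℂ L)] [∀ x, TopologicalSpace (L x)] [FiberBundle ℂ L]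

theorem exists_isComponents {k N : ℕ} {σ : Fin (N + 1) → ∀ x, ⨂[ℂ]^k (L x)}
    (hσ : ∀ i, IsHolomorphicSectionPow d k (σ i)) {U : Set X} {s : ∀ x, L x}
    (hs : IsHolomorphicFrame d U s) : ∃ F, IsComponents (d := d) k σ U s F := by
  choose f hf hfσ using fun i ↦ hσ i U s hs
  refine ⟨fun x ↦ WithLp.toLp 2 fun i ↦ f i x, ?_, fun x hx i ↦ hfσ i x hx⟩
  have h := (PiLp.continuousLinearEquiv 2 ℂ fun _ : Fin (N + 1) ↦ ℂ).symm.contDiff.contMDiff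
    (n := ω)
  exact h.comp_contMDiffOn (contMDiffOn_pi_space.2 hf)

theorem exists_isHolomorphicFrame [VectorBundle ℂ ℂ L] [ContMDiffVectorBundle ω ℂ L 𝓘(ℂ, CC d)]
    (x : X) : ∃ (U : Set X) (s : ∀ x, L x), IsHolomorphicFrame d U s ∧ x ∈ U := by
  set e := trivializationAt ℂ L x
  set b := Module.Basis.singleton Unit ℂ
  refine ⟨e.baseSet, e.localFrame b (), ⟨e.open_baseSet,
    e.contMDiffOn_localFrame_baseSet (I := 𝓘(ℂ, CC d)) ω b (), fun y hy ↦ ?_⟩,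
    FiberBundle.mem_baseSet_trivializationAt' x⟩
  exact ((e.isLocalFrameOn_localFrame_baseSet 𝓘(ℂ, CC d) ω b).linearIndependent hy).ne_zero ()

theorem exists_eq_smul_fiber [VectorBundle ℂ ℂ L] {x : X} {v : L x} (hv : v ≠ 0) (w : L x) :
    ∃ g : ℂ, w = g • v := by
  let e := (trivializationAt ℂ L x).continuousLinearEquivAt ℂ x
    (FiberBundle.mem_baseSet_trivializationAt' x)
  have he : e v ≠ 0 := by simpa using hv
  refine ⟨e w / e v, e.injective ?_⟩
  rw [map_smul, smul_eq_mul, div_mul_cancel₀ _ he]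

/-- Multiplying the frame by `g` divides the components by `g ^ k`. Taking logarithms, `-log ‖s‖² -
k⁻¹ log ‖F‖²` is independent of the frame, hence a global function. -/
theorem IsComponents.norm_mul_eq {k N : ℕ} {σ : Fin (N + 1) → ∀ x, ⨂[ℂ]^k (L x)} {U U' : Set X}
    {s s' : ∀ x, L x} {F F' : X → EuclideanSpace ℂ (Fin (N + 1))} [VectorBundle ℂ ℂ L]
    (h : HermitianMetric L)
    (hF : IsComponents (d := d) k σ U s F) (hF' : IsComponents (d := d) k σ U' s' F') {x : X}
    (hx : x ∈ U) (hx' : x ∈ U') {j} (hj : σ j x ≠ 0) (hs : s x ≠ 0) :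
    ‖F x‖ * h.fiberNorm x (s x) ^ k = ‖F' x‖ * h.fiberNorm x (s' x) ^ k := by
  obtain ⟨g, hg⟩ := exists_eq_smul_fiber hs (s' x)
  have ht := hF.tprod_ne_zero hx hj
  have e0 : PiTensorProduct.tprod ℂ (fun _ : Fin k ↦ s' x) =
      g ^ k • PiTensorProduct.tprod ℂ (fun _ : Fin k ↦ s x) := by
    have := (PiTensorProduct.tprod ℂ (s := fun _ : Fin k ↦ L x)).map_smul_univ
      (fun _ ↦ g) (fun _ ↦ s x)
    simpa [hg] using this
  have e1 : F x = g ^ k • F' x := by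
    ext i
    have e := (hF.eq_smul x hx i).symm.trans (hF'.eq_smul x hx' i)
    rw [e0, smul_smul] at e
    have := smul_left_injective ℂ ht e
    simpa [mul_comm] using this
  rw [e1, norm_smul, norm_pow, hg, map_smul_eq_mul, mul_pow]
  ring

end Potential

/-! ### Approximation of metrics -/

section Metric

variable {d : ℕ} {X : Type*} {L : X → Type*} [∀ x, AddCommGroup (L x)] [∀ x, Module ℂ (L x)]

/-- The metric `exp(f) ‖·‖`. -/
noncomputable def HermitianMetric.twist (h : HermitianMetric L) (f : X → ℝ) :
    HermitianMetric L where
  fiberNorm x := (Real.exp (f x)).toNNReal • h.fiberNorm x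
  pos x v hv := by
    rw [_root_.smul_apply, NNReal.smul_def, Real.coe_toNNReal _ (Real.exp_pos _).le]
    exact mul_pos (Real.exp_pos (f x)) (h.pos x v hv)

theorem HermitianMetric.twist_apply (h : HermitianMetric L) (f : X → ℝ) (x : X) (v : L x) :
    (h.twist f).fiberNorm x v = Real.exp (f x) * h.fiberNorm x v := by
  rw [twist, _root_.smul_apply, NNReal.smul_def, Real.coe_toNNReal _ (Real.exp_pos _).le,
    smul_eq_mul]

/-- If `f n` converges uniformly to `0`, the metrics `exp(f n) ‖·‖` converge uniformly. -/
theorem HermitianMetric.tendstoUnif_twist (h : HermitianMetric L) {f : ℕ → X → ℝ}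
    (hf : ∀ n x, |f n x| ≤ 1 / ((n : ℝ) + 1)) :
    HermitianMetric.TendstoUnif (fun n ↦ h.twist (f n)) h := by
  intro ε hε
  -- The factor `2` is that of `|exp t - 1| ≤ 2 |t|` for `|t| ≤ 1`.
  have hlim : Tendsto (fun n : ℕ ↦ 2 * (1 / ((n : ℝ) + 1))) atTop (𝓝 0) := by
    simpa using tendsto_one_div_add_atTop_nhds_zero_nat.const_mul (2 : ℝ)
  filter_upwards [hlim.eventually_lt_const hε] with n hn x v
  have h1 : |f n x| ≤ 1 := (hf n x).trans (by
    rw [div_le_one (by positivity)]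
    linarith [Nat.cast_nonneg (α := ℝ) n])
  have h2 := Real.abs_exp_sub_one_le h1
  have e : (h.twist (f n)).fiberNorm x v - h.fiberNorm x v =
      (Real.exp (f n x) - 1) * h.fiberNorm x v := by
    rw [HermitianMetric.twist_apply]; ring
  rw [e, abs_mul, abs_of_nonneg (apply_nonneg _ v)]
  refine mul_le_mul_of_nonneg_right ?_ (apply_nonneg _ v)
  linarith [hf n x]

theorem HermitianMetric.neg_log_twist_sq (h : HermitianMetric L) (f : X → ℝ) (x : X) {v : L x}
    (hv : v ≠ 0) : -Real.log ((h.twist f).fiberNorm x v ^ 2) =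
      -2 * f x - Real.log (h.fiberNorm x v ^ 2) := by
  rw [HermitianMetric.twist_apply, mul_pow,
    Real.log_mul (by positivity) (pow_ne_zero 2 (h.pos x v hv).ne'), Real.log_pow, Real.log_exp]
  push_cast
  ring

variable [TopologicalSpace X] [ChartedSpace (CC d) X]
  [TopologicalSpace (TotalSpace ℂ L)] [∀ x, TopologicalSpace (L x)] [FiberBundle ℂ L]
  [IsManifold 𝓘(ℂ, CC d) ω X]

/-- A metric with smooth weights of non-negative Levi form is smooth and positive. -/
theorem HermitianMetric.isSmooth_and_isPositive {h : HermitianMetric L}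
    (hw : ∀ (U : Set X) (s : ∀ x, L x), IsHolomorphicFrame d U s → ∃ w : X → ℝ,
      (∀ x ∈ U, -Real.log (h.fiberNorm x (s x) ^ 2) = w x) ∧
      ∀ x ∈ U, ContMDiffAt 𝓘(ℝ, CC d) 𝓘(ℝ, ℝ) ∞ w x ∧
        ∀ c ∈ atlas (CC d) X, x ∈ c.source → ∀ ξ : CC d, 0 ≤ chartLevi c w x ξ) :
    h.IsSmooth d ∧ h.IsPositive d := by
  refine ⟨fun U s hs ↦ ?_, fun U s hs c hc ↦ ?_⟩
  · obtain ⟨w, hwe, hws⟩ := hw U s hs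
    have hE : ContMDiffOn 𝓘(ℝ, CC d) 𝓘(ℝ, ℝ) ∞ (fun x ↦ Real.exp (-(2⁻¹ * w x))) U := fun x hx ↦ by
      have he : ContMDiffAt 𝓘(ℝ, ℝ) 𝓘(ℝ, ℝ) ∞ (fun t : ℝ ↦ Real.exp (-(2⁻¹ * t))) (w x) :=
        contMDiffAt_iff_contDiffAt.2 (by fun_prop)
      exact (ContMDiffAt.comp (g := fun t : ℝ ↦ Real.exp (-(2⁻¹ * t))) (f := w) x he
        (hws x hx).1).contMDiffWithinAt
    refine hE.congr fun x hx ↦ ?_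
    have hp := h.pos x (s x) (hs.ne_zero x hx)
    rw [← hwe x hx, Real.log_pow]
    push_cast
    rw [show -(2⁻¹ * -(2 * Real.log (h.fiberNorm x (s x)))) = Real.log (h.fiberNorm x (s x)) by
      ring, Real.exp_log hp]
  · obtain ⟨w, hwe, hws⟩ := hw U s hs
    have hV : IsOpen (c.target ∩ c.symm ⁻¹' U) := c.symm.isOpen_inter_preimage hs.isOpen
    have hev : ∀ z ∈ c.target ∩ c.symm ⁻¹' U,
        (fun z ↦ -Real.log (h.fiberNorm (c.symm z) (s (c.symm z)) ^ 2)) =ᶠ[𝓝 z]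
          fun z ↦ w (c.symm z) := fun z hz ↦ by
      filter_upwards [hV.mem_nhds hz] with y hy
      exact hwe _ hy.2
    refine DdcNonnegOn.of_leviForm_nonneg hV (fun z hz ↦ ?_) fun z hz ξ ↦ ?_
    · have := contDiffAt_comp_symm_real (hws _ hz.2).1 hc (c.map_target hz.1)
      rw [c.right_inv hz.1] at this
      exact this.congr_of_eventuallyEq (hev z hz)
    · have := (hws _ hz.2).2 c hc (c.map_target hz.1) ξ
      rw [chartLevi, c.right_inv hz.1] at this
      rwa [leviForm_congr (hev z hz)]

end Metric

/-! ### From metrics to functions and back -/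

theorem mainTheorem9 (d : ℕ) {X : Type*} [TopologicalSpace X] [T2Space X] [CompactSpace X]
    [ChartedSpace (CC d) X] [IsManifold 𝓘(ℂ, CC d) ω X]
    (L : X → Type*) [TopologicalSpace (TotalSpace ℂ L)] [∀ x, AddCommGroup (L x)]
    [∀ x, Module ℂ (L x)] [∀ x, TopologicalSpace (L x)] [FiberBundle ℂ L] [VectorBundle ℂ ℂ L]
    [ContMDiffVectorBundle ω ℂ L 𝓘(ℂ, CC d)]
    (hL : IsAmple d L) (h : HermitianMetric L)
    (hcont : h.IsContinuous d) (hpos : h.IsPositive d) :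
    h.IsAdmissible d := by
  refine ⟨hcont, hpos, ?_⟩
  obtain ⟨k, hk, N, σ, Φ, hσ, hΦ, -, himm⟩ := hL
  have hk0 : (k : ℝ) ≠ 0 := Nat.cast_ne_zero.2 hk.ne'
  have hσ0 : ∀ x, ∃ i, σ i x ≠ 0 := fun x ↦ by
    obtain ⟨e, he, hσe⟩ := hΦ x
    obtain ⟨i, hi⟩ : ∃ i, (Φ x).rep i ≠ 0 := Function.ne_iff.1 (Φ x).rep_nonzero
    exact ⟨i, by rw [hσe]; exact smul_ne_zero hi he⟩
  -- Potentials are indexed by all frames rather than by a cover, because smoothness and positivity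
  -- of a metric are conditions on every frame.
  let ι := {q : Set X × (∀ x, L x) // IsHolomorphicFrame d q.1 q.2}
  have hι : ∀ x, ∃ q : ι, x ∈ q.1.1 := fun x ↦ by
    obtain ⟨U, s, hs, hx⟩ := exists_isHolomorphicFrame (d := d) (L := L) x
    exact ⟨⟨(U, s), hs⟩, hx⟩
  choose F hF using fun q : ι ↦ exists_isComponents hσ q.2
  have hF0 : ∀ (q : ι), ∀ x ∈ q.1.1, F q x ≠ 0 := fun q x hx h0 ↦ by
    obtain ⟨i, hi⟩ := hσ0 x
    exact ((hF q).apply_ne_zero_iff hx hi i).2 hi (by simp [h0])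
  set p : ι → X → ℝ := fun q x ↦ (k : ℝ)⁻¹ * Real.log (‖F q x‖ ^ 2) with hpdef
  have hlog : ∀ (q : ι), ∀ x ∈ q.1.1, ContMDiffAt 𝓘(ℝ, CC d) 𝓘(ℝ, ℝ) ∞
      (fun y ↦ Real.log (‖F q y‖ ^ 2)) x := fun q x hx ↦ by
    have h1 := contMDiffAt_real_of_complex ((hF q).contMDiffAt q.2.isOpen hx)
    have h2 : ContDiffAt ℝ ∞ (fun v : EuclideanSpace ℂ (Fin (N + 1)) ↦ Real.log (‖v‖ ^ 2))
        (F q x) := (contDiffAt_id.norm_sq ℝ).log (by simpa using hF0 q x hx)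
    exact ContMDiffAt.comp (g := fun v : EuclideanSpace ℂ (Fin (N + 1)) ↦ Real.log (‖v‖ ^ 2))
      (f := F q) x (contMDiffAt_iff_contDiffAt.2 h2) h1
  have hp : IsKahlerPotential (d := d) (fun q : ι ↦ q.1.1) p := by
    refine ⟨fun q ↦ q.2.isOpen, hι, fun q x hx ↦ contMDiffAt_const.mul (hlog q x hx),
      fun q q' x hx hx' c hc hxc ξ ↦ ?_, fun q x hx c hc hxc ξ hξ ↦ ?_⟩
    · rw [chartLevi_const_mul hc hxc (hlog q x hx), chartLevi_const_mul hc hxc (hlog q' x hx'),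
        (hF q).chartLevi_log_norm_sq_eq (hF q') q.2.isOpen q'.2.isOpen hσ0 hx hx' hc hxc]
    · rw [chartLevi_const_mul hc hxc (hlog q x hx)]
      refine mul_pos (by positivity) ((hF q).leviForm_log_norm_sq_pos q.2.isOpen hΦ himm hc
        (c.map_source hxc) ?_ hξ)
      rwa [c.left_inv hxc]
  choose q₀ hq₀ using hι
  -- `φ` is the logarithm of the squared ratio of the Fubini–Study metric to `h`. The frame chosen
  -- at each point is arbitrary and may jump; `hφ` shows that every frame gives the same value.
  set φ : X → ℝ := fun x ↦ -Real.log (h.fiberNorm x ((q₀ x).1.2 x) ^ 2) - p (q₀ x) x with hφdef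
  have hφ : ∀ (q : ι), ∀ x ∈ q.1.1,
      φ x + p q x = -Real.log (h.fiberNorm x (q.1.2 x) ^ 2) := fun q x hx ↦ by
    obtain ⟨j, hj⟩ := hσ0 x
    have hn := (hF q).norm_mul_eq h (hF (q₀ x)) hx (hq₀ x) hj (q.2.ne_zero x hx)
    have a1 := norm_pos_iff.2 (hF0 q x hx)
    have a2 := norm_pos_iff.2 (hF0 _ x (hq₀ x))
    have a3 := h.pos x _ (q.2.ne_zero x hx)
    have a4 := h.pos x _ ((q₀ x).2.ne_zero x (hq₀ x))
    have hl := congrArg Real.log hn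
    rw [Real.log_mul a1.ne' (pow_pos a3 k).ne', Real.log_mul a2.ne' (pow_pos a4 k).ne',
      Real.log_pow, Real.log_pow] at hl
    simp only [hφdef, hpdef, Real.log_pow]
    field_simp
    linear_combination hl
  have happrox := fun n : ℕ ↦ hp.exists_smooth_approx (φ := φ) (ε := 1 / ((n : ℝ) + 1))
    (fun q ↦ by
      refine ContinuousOn.congr (f := fun x ↦ -Real.log (h.fiberNorm x (q.1.2 x) ^ 2)) ?_ (hφ q)
      exact (((hcont _ _ q.2).pow 2).log fun x hx ↦
        pow_ne_zero 2 (h.pos x _ (q.2.ne_zero x hx)).ne').neg)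
    (fun q c hc ↦ by
      intro χ h1 h2 h3 h4 ξ
      refine (hpos _ _ q.2 c hc χ h1 h2 h3 h4 ξ).trans_eq
        (integral_congr_ae (.of_forall fun z ↦ ?_))
      by_cases hz : z ∈ tsupport χ
      · simp only [hφ q _ (h3 hz).2]
      · simp only [leviForm_eq_zero_of_notMem_tsupport hz, mul_zero])
    (by positivity)
  choose ψ hψs hψφ hψl using happrox
  -- This factor changes the weight `φ + p` into `ψ n + p`; the half appears because weights use the
  -- squared norm.
  refine ⟨fun n ↦ h.twist fun x ↦ (φ x - ψ n x) / 2, fun n ↦ ?_,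
    h.tendstoUnif_twist fun n x ↦ ?_⟩
  · refine HermitianMetric.isSmooth_and_isPositive fun U s hs ↦ ?_
    let q : ι := ⟨(U, s), hs⟩
    refine ⟨fun x ↦ ψ n x + p q x, fun x hx ↦ ?_, fun x hx ↦
      ⟨(hψs n).contMDiffAt.add (hp.smooth q x hx), fun c hc hxc ξ ↦ ?_⟩⟩
    · have := hφ q x hx
      rw [h.neg_log_twist_sq _ _ (hs.ne_zero x hx)]
      change φ x + p q x = -Real.log (h.fiberNorm x (s x) ^ 2) at this
      linarith
    · rw [chartLevi_add hc hxc (hψs n).contMDiffAt (hp.smooth q x hx)]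
      exact hψl n q x hx c hc hxc ξ
  · have := hψφ n x
    rw [abs_sub_comm] at this
    rw [abs_div, abs_of_pos (by norm_num : (0 : ℝ) < 2)]
    linarith [abs_nonneg (φ x - ψ n x)]
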